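/- **Setting.** For an invertible real $2\times2$ matrix $L$ and $\mathbf r\in\mathbb R^2$ let $\lfloor \mathbf r\rfloor_L=\lfloor L^{-1}\mathbf r\rfloor\in\mathbb Z^2$ (entrywise floor) and $\{\mathbf r\}_L=\mathbf r-L\lfloor\mathbf r\rfloor_L$. Let $V\in\mathbb R^{2\times 2}$ with $|V|=\det V>0$ (its columns are the primitive vectors of a two-dimensional crystal) and let $T\in\mathbb Z^{2\times2}$ with $|T|=\det T>0$ (the columns of $VT$ are the primitive vectors of the magnetic lattice). The basis consists of atoms $n=1,\dots,N_{atom}$ at positions $\mathbf R_n\in\mathbb R^2$ relative to the lattice points $V\mathbf j$, $\mathbf j\in\mathbb Z^2$. The hopping network is a finite list $(n_m,n_m',\mathbf\Delta_m,t_m)$, $m=1,\dots,N_{hop}$, with $\mathbf \Delta_m\in\mathbb Z^2$ and $0\ne t_m\in\mathbb C$: an electron hops from atom $n_m$ of unit cell $\mathbf j$ to atom $n_m'$ of unit cell $\mathbf j+\mathbf\Delta_m$ with energy $t_m$, and back with energy $t_m^*$, for every $\mathbf j$. No hopping is listed twice, neither directly nor through its reverse $(n_m',n_m,-\mathbf\Delta_m)$,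 and the resulting graph on all atoms $\mathbb Z^2\times\{1,\dots,N_{atom}\}$ is connected (in particular nonempty). Put $$S_{hop}=\{\mathbf\Delta_m+V^{-1}(\mathbf R_{n_m'}-\mathbf R_{n_m}) : 1\le m\le N_{hop}\},\qquad J=\{\mathbf j\in\mathbb Z^2:\lfloor\mathbf j\rfloor_T=\mathbf 0\},$$ and abbreviate $\mathbf s_{\mathbf j,m}=\lfloor\mathbf j+\mathbf\Delta_m\rfloor_T$ and $\mathbf j'_m=\{\mathbf j+\mathbf\Delta_m\}_T\in J$ for $\mathbf j\in J$. Let $h>0$, $\hbar=h/2\pi$, $q\in\mathbb R\setminus\{0\}$. Let $c_{\mathbf i,(\mathbf j,n)},c^\dagger_{\mathbf i,(\mathbf j,n)}$ ($\mathbf i\in\mathbb Z^2$, $\mathbf j\in J$, $1\le n\le N_{atom}$) be the fermionic annihilation and creation operators on the space $\mathcal F$ of finite linear combinations of the occupation-number states $|F\rangle$, $F$ a finite set of sites $(\mathbf i,(\mathbf j,n))$; the states $|F\rangle$ are orthonormal. For a vector potential $\mathbf A$ the real-space Hamiltonian is $$\mathrm H=-\sum_{\mathbf i\in\mathbb Z^2,\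 \mathbf j\in J,\ m}t_m\exp\Big(i\frac q\hbar\int_{V(T\mathbf i+\mathbf j)+\mathbf R_{n_m}}^{V(T\mathbf i+\mathbf j+\mathbf\Delta_m)+\mathbf R_{n_m'}}\mathbf A\cdot d\mathbf r\Big)\,c^\dagger_{\mathbf i+\mathbf s_{\mathbf j,m},(\mathbf j'_m,n_m')}\,c_{\mathbf i,(\mathbf j,n_m)}+h.c.,$$ with the integral along the straight segment; for a gradient term one sets $\int_{\mathbf x}^{\mathbf y}\nabla\Lambda\cdot d\mathbf r=\Lambda(\mathbf y)-\Lambda(\mathbf x)$, also when $\Lambda$ has jumps. Let $BZ\subset\mathbb R^2$ (the Brillouin zone) be any fundamental domain of the reciprocal lattice spanned by the columns of $2\pi(V^T)^{-1}(T^T)^{-1}$, and for $\mathbf k\in\mathbb R^2$ let $$c_{\mathbf k,\alpha}=\frac{\sqrt{|V||T|}}{2\pi}\sum_{\mathbf i\in\mathbb Z^2}e^{-i(VT\mathbf i)\cdot\mathbf k}\,c_{\mathbf i,\alpha}\qquad(\alpha=(\mathbf j,n)).$$ An identity $\mathrm H=\iint_{BZ}d^2\mathbf k\,H_{\mathbf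 k}$, where $H_{\mathbf k}$ is a linear combination of products $c^\dagger_{\mathbf k,\alpha}c_{\mathbf k,\beta}$, means that $\langle\varphi,\mathrm H\psi\rangle=\iint_{BZ}\langle\varphi,H_{\mathbf k}\psi\rangle\,d^2\mathbf k$ with integrable integrand for all $\varphi,\psi\in\mathcal F$, where $\langle\varphi,c^\dagger_{\mathbf k,\alpha}c_{\mathbf k,\beta}\psi\rangle=\langle c_{\mathbf k,\alpha}\varphi,c_{\mathbf k,\beta}\psi\rangle$. We say that $\mathrm H$ *has no $\mathbf k$-mixing* if $\mathrm H=\iint_{BZ}d^2\mathbf k\sum_{\alpha,\beta}g_{\alpha\beta}(\mathbf k)\,c^\dagger_{\mathbf k,\alpha}c_{\mathbf k,\beta}$ for some functions $g_{\alpha\beta}$ integrable over $BZ$. Let $A$ be a real $2\times2$ matrix (the flux per unit cell, in units of the flux quantum, is then $\Phi=A_{21}-A_{12}$). **Theorem.** (1) Let $\mathbf A(\mathbf r)=\frac hq(V^T)^{-1}AV^{-1}\mathbf r$. Each of the following two statements holds if and only if $T^TA^T\mathbf R\in\mathbb Z^2$ for all $\mathbf R\in S_{hop}$: * $\mathrm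 H$ has no $\mathbf k$-mixing; * $\mathrm H=\iint_{BZ}d^2\mathbf k\,H_{\mathbf k}$ with $$H_{\mathbf k}=-\sum_{\mathbf j\in J,\ m}t_m\exp\Big(-i(VT\mathbf s_{\mathbf j,m})\cdot\mathbf k+2\pi i\int_{\mathbf j+V^{-1}\mathbf R_{n_m}}^{\mathbf j+\mathbf\Delta_m+V^{-1}\mathbf R_{n_m'}}(A\mathbf R)\cdot d\mathbf R\Big)\,c^\dagger_{\mathbf k,(\mathbf j'_m,n_m')}\,c_{\mathbf k,(\mathbf j,n_m)}+h.c.$$ (2) Suppose that the atoms of the basis lie in the unit cell, i.e. $\lfloor\mathbf R_n\rfloor_V=\mathbf 0$ for all $n$. For $\mathbf r\in\mathbb R^2$ let $\mathbf i(\mathbf r)=\lfloor\lfloor\mathbf r\rfloor_V\rfloor_T$ be the index of the magnetic unit cell containing $\mathbf r$ and $\boldsymbol\rho(\mathbf r)=\mathbf r-VT\,\mathbf i(\mathbf r)$ the position relative to its origin. Let $\mathbf A(\mathbf r)=\frac hq(V^T)^{-1}AV^{-1}\mathbf r+\nabla\Lambda(\mathbf r)$ with $$\Lambda(\mathbf r)=-\frac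 hq\big((V^T)^{-1}AT\,\mathbf i(\mathbf r)\big)\cdot\boldsymbol\rho(\mathbf r)-\frac h{2q}\,\boldsymbol\rho(\mathbf r)^T(V^T)^{-1}AV^{-1}\boldsymbol\rho(\mathbf r).$$ Each of the following two statements holds if and only if $T^TAT\in\mathbb Z^{2\times2}$: * $\mathrm H$ has no $\mathbf k$-mixing; * $\mathrm H=\iint_{BZ}d^2\mathbf k\,H_{\mathbf k}$ with $H_{\mathbf k}=-\sum_{\mathbf j\in J,\ m}t_m\,e^{i\theta_{\mathbf j,m}(\mathbf k)}\,c^\dagger_{\mathbf k,(\mathbf j'_m,n_m')}c_{\mathbf k,(\mathbf j,n_m)}+h.c.$, where, with $\mathbf x=\mathbf j+V^{-1}\mathbf R_{n_m}$ and $\mathbf y=\mathbf j'_m+V^{-1}\mathbf R_{n_m'}$, $$\theta_{\mathbf j,m}(\mathbf k)=-\mathbf k\cdot(VT\mathbf s_{\mathbf j,m})+\pi\,\mathbf s_{\mathbf j,m}^TT^T\tfrac{A+A^T}2T\mathbf s_{\mathbf j,m}+2\pi\,\mathbf y^T\tfrac{A-A^T}2\mathbf x+2\pi\,\mathbf s_{\mathbf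 j,m}^TT^T\tfrac{A-A^T}2(\mathbf y+\mathbf x).$$ -/

import Mathlib

open MeasureTheory Matrix
open scoped ComplexConjugate

noncomputable section

namespace TightBinding

/-- Column vectors of the plane (dot product `⬝ᵥ`, Lebesgue measure `volume`). -/
abbrev Vec : Type := Fin 2 → ℝ

/-- Integer column vectors. -/
abbrev IVec : Type := Fin 2 → ℤ

/-- The real vector with the given integer entries. -/
def IVec.toVec (v : IVec) : Vec := fun a => (v a : ℝ)

/-- `⌊r⌋_L = ⌊L⁻¹ r⌋`, taken entrywise. -/
def latticeFloor (L : Matrix (Fin 2) (Fin 2) ℝ) (r : Vec) : IVec :=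
  fun a => ⌊(L⁻¹ *ᵥ r) a⌋

/-! ### Fermionic Fock space

For a linearly ordered set `S` of one-electron sites, `Fock S` is the space of finite linear
combinations of the occupation-number states `|F⟩`, `F` a finite set of occupied sites. -/

/-- Finite linear combinations of occupation-number states. -/
abbrev Fock (S : Type) : Type := Finset S →₀ ℂ

/-- The inner product for which the occupation-number states are orthonormal
(conjugate-linear in the first argument). -/
def Fock.inner {S : Type} (φ ψ : Fock S) : ℂ := φ.sum fun F z => conj z * ψ F

section Operators

variable {S : Type} [LinearOrder S]

/-- The sign `(-1) ^ #{y ∈ F | y < x}` picked up when an electron at `x` is moved through the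
ordered product of creation operators that defines `|F⟩`. -/
def fermionSign (x : S) (F : Finset S) : ℂ := (-1) ^ (F.filter (fun y => y < x)).card

/-- The creation operator `c†_x`. -/
def create (x : S) : Fock S →ₗ[ℂ] Fock S :=
  Finsupp.linearCombination ℂ fun F : Finset S =>
    if x ∈ F then (0 : Fock S) else Finsupp.single (insert x F) (fermionSign x F)

/-- The annihilation operator `c_x`. -/
def annihilate (x : S) : Fock S →ₗ[ℂ] Fock S :=
  Finsupp.linearCombination ℂ fun F : Finset S =>
    if x ∈ F then Finsupp.single (F.erase x) (fermionSign x F) else (0 : Fock S)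

/-- Only finitely many sites are occupied in a given vector, so the sums over cells below are
finite on each vector. -/
theorem finite_annihilate_ne_zero (ψ : Fock S) : {x : S | annihilate x ψ ≠ 0}.Finite := by
  refine (ψ.support.biUnion id).finite_toSet.subset ?_
  intro x hx
  by_contra hcon
  apply hx
  rw [annihilate, Finsupp.linearCombination_apply, Finsupp.sum]
  refine Finset.sum_eq_zero fun F hF => ?_
  have : x ∉ F := fun h => hcon (by
    simp only [Finset.coe_biUnion, Set.mem_iUnion]
    exact ⟨F, hF, h⟩)
  simp [this]

end Operators

/-! ### Vector potentials -/

/-- The vector potential `field + ∇ gauge`. The gauge function may jump, so the gradient is a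
distribution, and all that is used of it is the line integral below. -/
structure VectorPotential where
  field : Vec → Vec
  gauge : Vec → ℝ

/-- The line integral `∫ a · dr` of an ordinary vector field along the segment from `x` to `y`. -/
def segmentIntegral (a : Vec → Vec) (x y : Vec) : ℝ :=
  ∫ s in (0 : ℝ)..1, a (x + s • (y - x)) ⬝ᵥ (y - x)

/-- The line integral of `field + ∇ gauge` along the segment from `x` to `y`; the integral of the
(distributional) gradient is the difference of the end-point values. -/
def VectorPotential.lineIntegral (a : VectorPotential) (x y : Vec) : ℝ :=
  segmentIntegral a.field x y + (a.gauge y - a.gauge x)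

/-! ### The crystal, its hopping network and the magnetic lattice -/

/-- A two-dimensional crystal with `N` atoms in its basis and `M` hoppings, and a magnetic
lattice. Hopping `m` goes from atom `src m` of unit cell `j` to atom `tgt m` of unit cell
`j + Δ m` with hopping energy `t m` (and back with the conjugate energy), for every `j`. -/
structure Crystal (N M : ℕ) where
  /-- columns: primitive vectors of the lattice -/
  V : Matrix (Fin 2) (Fin 2) ℝ
  V_pos : 0 < V.det
  /-- columns: primitive vectors of the magnetic lattice, in units of the columns of `V` -/
  T : Matrix (Fin 2) (Fin 2) ℤ
  T_pos : 0 < T.det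
  /-- position of an atom relative to the lattice point of its unit cell -/
  pos : Fin N → Vec
  src : Fin M → Fin N
  tgt : Fin M → Fin N
  Δ : Fin M → IVec
  t : Fin M → ℂ
  /-- the listed hoppings are really there -/
  t_ne : ∀ m, t m ≠ 0
  /-- no hopping is listed twice ... -/
  hop_inj : ∀ m m', src m = src m' → tgt m = tgt m' → Δ m = Δ m' → m = m'
  /-- ... nor a second time through its reverse -/
  hop_inj_rev : ∀ m m', src m = tgt m' → tgt m = src m' → Δ m = -Δ m' → m = m'
  /-- the hopping network on all atoms `(j, n)` of the crystal is connected -/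
  connected : (SimpleGraph.fromRel fun x y : IVec × Fin N =>
    ∃ m, x.2 = src m ∧ y.2 = tgt m ∧ y.1 = x.1 + Δ m).Connected

namespace Crystal

variable {N M : ℕ} (C : Crystal N M)

/-- `T` as a real matrix. -/
def Tr : Matrix (Fin 2) (Fin 2) ℝ := C.T.map (Int.cast : ℤ → ℝ)

/-- `⌊v⌋_T` for an integer vector. -/
def floorT (v : IVec) : IVec := latticeFloor C.Tr v.toVec

/-- `{v}_T = v - T ⌊v⌋_T` for an integer vector. -/
def remT (v : IVec) : IVec := v - C.T *ᵥ C.floorT v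

/-- The set `J` of unit cells that make up the magnetic unit cell at the origin. -/
def J : Set IVec := {j | C.floorT j = 0}

theorem Tr_det_ne : C.Tr.det ≠ 0 := by
  have h : C.Tr.det = (C.T.det : ℝ) := (Int.cast_det C.T).symm
  rw [h]
  exact_mod_cast C.T_pos.ne'

theorem remT_mem (v : IVec) : C.remT v ∈ C.J := by
  have hu : IsUnit C.Tr.det := isUnit_iff_ne_zero.mpr C.Tr_det_ne
  have h1 : (C.remT v).toVec = v.toVec - C.Tr *ᵥ (C.floorT v).toVec := by
    funext a
    fin_cases a <;> simp [remT, IVec.toVec, Tr]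
  funext a
  change ⌊(C.Tr⁻¹ *ᵥ (C.remT v).toVec) a⌋ = 0
  rw [h1, Matrix.mulVec_sub, Matrix.mulVec_mulVec, Matrix.nonsing_inv_mul _ hu,
    Matrix.one_mulVec]
  change ⌊(C.Tr⁻¹ *ᵥ v.toVec) a - ((⌊(C.Tr⁻¹ *ᵥ v.toVec) a⌋ : ℤ) : ℝ)⌋ = 0
  rw [Int.floor_sub_intCast, sub_self]

instance finite_J : Finite C.J := by
  have hu : IsUnit C.Tr.det := isUnit_iff_ne_zero.mpr C.Tr_det_ne
  let b : Fin 2 → ℤ := fun a => |C.T a 0| + |C.T a 1|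
  have hb : C.J ⊆ Set.Icc (-b) b := by
    intro j hj
    have hx : ∀ a, 0 ≤ (C.Tr⁻¹ *ᵥ j.toVec) a ∧ (C.Tr⁻¹ *ᵥ j.toVec) a < 1 := fun a =>
      Int.floor_eq_zero_iff.mp (congrFun hj a)
    have hT : j.toVec = C.Tr *ᵥ (C.Tr⁻¹ *ᵥ j.toVec) := by
      rw [Matrix.mulVec_mulVec, Matrix.mul_nonsing_inv _ hu, Matrix.one_mulVec]
    have key : ∀ a, |(j a : ℝ)| ≤ (b a : ℝ) := by
      intro a
      have h := congrFun hT a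
      set x := C.Tr⁻¹ *ᵥ j.toVec
      have h' : (j a : ℝ) = (C.T a 0 : ℝ) * x 0 + (C.T a 1 : ℝ) * x 1 := by
        simpa [IVec.toVec, Matrix.mulVec, dotProduct, Tr, Fin.sum_univ_two] using h
      have e0 : |(C.T a 0 : ℝ) * x 0| ≤ |(C.T a 0 : ℝ)| := by
        rw [abs_mul, abs_of_nonneg (hx 0).1]
        exact mul_le_of_le_one_right (abs_nonneg _) (hx 0).2.le
      have e1 : |(C.T a 1 : ℝ) * x 1| ≤ |(C.T a 1 : ℝ)| := by
        rw [abs_mul, abs_of_nonneg (hx 1).1]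
        exact mul_le_of_le_one_right (abs_nonneg _) (hx 1).2.le
      rw [h']
      refine (abs_add_le _ _).trans ?_
      simp only [b, Int.cast_add, Int.cast_abs]
      linarith
    have key' : ∀ a, |j a| ≤ b a := fun a => by exact_mod_cast key a
    exact ⟨fun a => (abs_le.mp (key' a)).1, fun a => (abs_le.mp (key' a)).2⟩
  exact (Set.finite_Icc (-b) b).subset hb

instance fintypeJ : Fintype C.J := Fintype.ofFinite _

/-- The atoms `(j, n)`, `j ∈ J`, of a magnetic unit cell. -/
abbrev Orbital : Type := C.J × Fin N

/-- The atoms of the crystal, labelled by magnetic unit cell and atom of it. -/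
@[ext]
structure Site where
  cell : IVec
  orb : C.Orbital

/-- The orbital `(j, n_m)` from which hopping `m` starts. -/
def orbSrc (j : C.J) (m : Fin M) : C.Orbital := (j, C.src m)

/-- The orbital `({j + Δ_m}_T, n_m')` at which hopping `m` ends. -/
def orbTgt (j : C.J) (m : Fin M) : C.Orbital :=
  (⟨C.remT (j.1 + C.Δ m), C.remT_mem _⟩, C.tgt m)

/-- `⌊j + Δ_m⌋_T`, the change of magnetic unit cell in hopping `m` from unit cell `j`. -/
def shift (j : C.J) (m : Fin M) : IVec := C.floorT (j.1 + C.Δ m)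

/-- The site `(i, (j, n_m))`. -/
def siteSrc (i : IVec) (j : C.J) (m : Fin M) : C.Site := ⟨i, C.orbSrc j m⟩

/-- The site `(i + ⌊j + Δ_m⌋_T, ({j + Δ_m}_T, n_m'))`. -/
def siteTgt (i : IVec) (j : C.J) (m : Fin M) : C.Site := ⟨i + C.shift j m, C.orbTgt j m⟩

/-- The point `V (T i + j) + R_{n_m}`. -/
def startPoint (i : IVec) (j : C.J) (m : Fin M) : Vec :=
  C.V *ᵥ IVec.toVec (C.T *ᵥ i + j.1) + C.pos (C.src m)

/-- The point `V (T i + j + Δ_m) + R_{n_m'}`. -/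
def endPoint (i : IVec) (j : C.J) (m : Fin M) : Vec :=
  C.V *ᵥ IVec.toVec (C.T *ᵥ i + j.1 + C.Δ m) + C.pos (C.tgt m)

/-- `S_hop`, the hopping vectors in units of the columns of `V`. -/
def hopVectors : Set Vec :=
  Set.range fun m => (C.Δ m).toVec + C.V⁻¹ *ᵥ (C.pos (C.tgt m) - C.pos (C.src m))

/-- `j(r)`, the unit cell containing `r`. -/
def unitCell (r : Vec) : IVec := latticeFloor C.V r

/-- `i(r)`, the magnetic unit cell containing `r`. -/
def magCell (r : Vec) : IVec := C.floorT (C.unitCell r)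

/-- The position of `r` relative to the origin of the magnetic unit cell containing it. -/
def magRem (r : Vec) : Vec := r - C.V *ᵥ (C.Tr *ᵥ (C.magCell r).toVec)

/-! ### The two vector potentials -/

/-- `(h / q) (Vᵀ)⁻¹ A V⁻¹ r`. -/
def linearField (h q : ℝ) (A : Matrix (Fin 2) (Fin 2) ℝ) (r : Vec) : Vec :=
  (h / q) • ((C.Vᵀ)⁻¹ *ᵥ (A *ᵥ (C.V⁻¹ *ᵥ r)))

/-- The linear vector potential. -/
def linearPotential (h q : ℝ) (A : Matrix (Fin 2) (Fin 2) ℝ) : VectorPotential where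
  field := C.linearField h q A
  gauge := 0

/-- The gauge function `Λ`. -/
def gaugeFunction (h q : ℝ) (A : Matrix (Fin 2) (Fin 2) ℝ) (r : Vec) : ℝ :=
  -(h / q) * (((C.Vᵀ)⁻¹ *ᵥ (A *ᵥ (C.Tr *ᵥ (C.magCell r).toVec))) ⬝ᵥ C.magRem r)
    - (h / (2 * q)) * (C.magRem r ⬝ᵥ ((C.Vᵀ)⁻¹ *ᵥ (A *ᵥ (C.V⁻¹ *ᵥ C.magRem r))))

/-- The nonlinear vector potential: the linear one plus `∇Λ`. -/
def nonlinearPotential (h q : ℝ) (A : Matrix (Fin 2) (Fin 2) ℝ) : VectorPotential where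
  field := C.linearField h q A
  gauge := C.gaugeFunction h q A

/-! ### The real-space Hamiltonian -/

/-- The Peierls amplitude `t_m exp (i (q / ħ) ∫ a · dr)`, with `ħ = h / 2π`. -/
def peierls (h q : ℝ) (a : VectorPotential) (i : IVec) (j : C.J) (m : Fin M) : ℂ :=
  C.t m * Complex.exp (Complex.I *
    ((q / (h / (2 * Real.pi)) * a.lineIntegral (C.startPoint i j m) (C.endPoint i j m) : ℝ) : ℂ))

/-! ### The reciprocal lattice -/

/-- The reciprocal lattice of the magnetic lattice, spanned by the columns of
`2π (Vᵀ)⁻¹ (Tᵀ)⁻¹`. -/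
def reciprocalLattice : AddSubgroup Vec :=
  AddSubgroup.closure
    (Set.range fun a : Fin 2 => ((2 * Real.pi) • ((C.Vᵀ)⁻¹ * (C.Trᵀ)⁻¹)).col a)

/-- `(V T i) · k`. -/
def blochPhase (i : IVec) (k : Vec) : ℝ := (C.V *ᵥ (C.Tr *ᵥ i.toVec)) ⬝ᵥ k

/-! ### The phases of the two momentum-space kernels -/

/-- `j + V⁻¹ R_{n_m}`. -/
def startRel (j : C.J) (m : Fin M) : Vec := j.1.toVec + C.V⁻¹ *ᵥ C.pos (C.src m)

/-- `{j + Δ_m}_T + V⁻¹ R_{n_m'}`. -/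
def endRel (j : C.J) (m : Fin M) : Vec :=
  (C.remT (j.1 + C.Δ m)).toVec + C.V⁻¹ *ᵥ C.pos (C.tgt m)

/-- The phase of the kernel for the linear vector potential. -/
def linearPhase (A : Matrix (Fin 2) (Fin 2) ℝ) (k : Vec) (j : C.J) (m : Fin M) : ℝ :=
  -C.blochPhase (C.shift j m) k
    + 2 * Real.pi * segmentIntegral (fun R => A *ᵥ R) (C.startRel j m)
        ((j.1 + C.Δ m).toVec + C.V⁻¹ *ᵥ C.pos (C.tgt m))

/-- The phase of the kernel for the nonlinear vector potential. -/
def nonlinearPhase (A : Matrix (Fin 2) (Fin 2) ℝ) (k : Vec) (j : C.J) (m : Fin M) : ℝ :=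
  let Asym : Matrix (Fin 2) (Fin 2) ℝ := (1 / 2 : ℝ) • (A + Aᵀ)
  let Aasym : Matrix (Fin 2) (Fin 2) ℝ := (1 / 2 : ℝ) • (A - Aᵀ)
  let D : Vec := (C.Tr *ᵥ (C.shift j m).toVec);
  (-C.blochPhase (C.shift j m) k)
    + Real.pi * (D ⬝ᵥ (Asym *ᵥ D))
    + 2 * Real.pi * (C.endRel j m ⬝ᵥ (Aasym *ᵥ C.startRel j m))
    + 2 * Real.pi * (D ⬝ᵥ (Aasym *ᵥ (C.endRel j m + C.startRel j m)))

variable [LinearOrder C.Site]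

/-- The summand of the Hamiltonian for hopping `m` from unit cell `j` of magnetic unit cell `i`:
amplitude times `c†_tgt c_src`, plus the Hermitian conjugate. -/
def hopTerm (h q : ℝ) (a : VectorPotential) (ψ : Fock C.Site) (i : IVec) (j : C.J) (m : Fin M) :
    Fock C.Site :=
  C.peierls h q a i j m • create (C.siteTgt i j m) (annihilate (C.siteSrc i j m) ψ)
    + conj (C.peierls h q a i j m) •
        create (C.siteSrc i j m) (annihilate (C.siteTgt i j m) ψ)

/-- The real-space Hamiltonian. On each vector the sum over `i` is finite, see
`finite_support_hamiltonian`. -/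
def hamiltonian (h q : ℝ) (a : VectorPotential) (ψ : Fock C.Site) : Fock C.Site :=
  -∑ᶠ i : IVec, ∑ j : C.J, ∑ m : Fin M, C.hopTerm h q a ψ i j m

theorem finite_support_hamiltonian (h q : ℝ) (a : VectorPotential) (ψ : Fock C.Site) :
    (Function.support fun i : IVec => ∑ j : C.J, ∑ m : Fin M, C.hopTerm h q a ψ i j m).Finite := by
  have hf := finite_annihilate_ne_zero ψ
  have hs : ∀ (j : C.J) (m : Fin M), {i : IVec | annihilate (C.siteSrc i j m) ψ ≠ 0}.Finite :=
    fun j m => hf.preimage (f := fun i => C.siteSrc i j m)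
      (fun i _ i' _ e => congrArg Site.cell e)
  have ht : ∀ (j : C.J) (m : Fin M), {i : IVec | annihilate (C.siteTgt i j m) ψ ≠ 0}.Finite :=
    fun j m => hf.preimage (f := fun i => C.siteTgt i j m)
      (fun i _ i' _ e => add_right_cancel (congrArg Site.cell e))
  refine (Set.finite_iUnion fun j : C.J => Set.finite_iUnion fun m : Fin M =>
    (hs j m).union (ht j m)).subset ?_
  intro i hi
  by_contra hcon
  simp only [Set.mem_iUnion, Set.mem_union, Set.mem_ofPred_eq, not_exists, not_or, not_not] at hcon
  apply hi
  refine Finset.sum_eq_zero fun j _ => Finset.sum_eq_zero fun m _ => ?_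
  simp [hopTerm, (hcon j m).1, (hcon j m).2]

/-! ### Momentum space -/

/-- `c_{k, α} = √(|V| |T|) / 2π ∑_i exp (-i (V T i) · k) c_{i, α}`; on each vector the sum is
finite, see `finite_support_annihilateK`. -/
def annihilateK (k : Vec) (α : C.Orbital) (ψ : Fock C.Site) : Fock C.Site :=
  ((Real.sqrt (C.V.det * C.Tr.det) / (2 * Real.pi) : ℝ) : ℂ) •
    ∑ᶠ i : IVec, Complex.exp (-Complex.I * (C.blochPhase i k : ℂ)) • annihilate ⟨i, α⟩ ψ

theorem finite_support_annihilateK (k : Vec) (α : C.Orbital) (ψ : Fock C.Site) :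
    (Function.support fun i : IVec =>
      Complex.exp (-Complex.I * (C.blochPhase i k : ℂ)) • annihilate (⟨i, α⟩ : C.Site) ψ).Finite := by
  have hf := (finite_annihilate_ne_zero ψ).preimage (f := fun i : IVec => (⟨i, α⟩ : C.Site))
    (fun i _ i' _ e => congrArg Site.cell e)
  refine hf.subset fun i hi => ?_
  simp only [Set.mem_preimage, Set.mem_ofPred_eq]
  intro h0
  apply hi
  simp [h0]

/-- The matrix element `⟨φ, c†_{k, α} c_{k, β} ψ⟩ = ⟨c_{k, α} φ, c_{k, β} ψ⟩`. (The operator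
`c†_{k, α}` alone creates a plane wave, which is not in the Fock space.) -/
def bilinearK (k : Vec) (α β : C.Orbital) (φ ψ : Fock C.Site) : ℂ :=
  Fock.inner (C.annihilateK k α φ) (C.annihilateK k β ψ)

/-- The matrix element `⟨φ, H_k ψ⟩` of
`H_k = -∑_{j, m} t_m exp (i θ j m) c†_{k, tgt} c_{k, src} + h.c.` for given hopping phases `θ`. -/
def kernelForm (θ : C.J → Fin M → ℝ) (k : Vec) (φ ψ : Fock C.Site) : ℂ :=
  -∑ j : C.J, ∑ m : Fin M,
    (C.t m * Complex.exp (Complex.I * (θ j m : ℂ))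
        * C.bilinearK k (C.orbTgt j m) (C.orbSrc j m) φ ψ
      + conj (C.t m * Complex.exp (Complex.I * (θ j m : ℂ)))
        * C.bilinearK k (C.orbSrc j m) (C.orbTgt j m) φ ψ)

/-- `H = ∫_BZ H_k d²k`, as an identity of matrix elements. -/
def EqBZIntegral (BZ : Set Vec) (H : Fock C.Site → Fock C.Site)
    (Hk : Vec → Fock C.Site → Fock C.Site → ℂ) : Prop :=
  ∀ φ ψ : Fock C.Site,
    IntegrableOn (fun k => Hk k φ ψ) BZ volume ∧ Fock.inner φ (H ψ) = ∫ k in BZ, Hk k φ ψ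

/-- `H` has no `k`-mixing: it is `∫_BZ ∑_{α, β} g_{α β}(k) c†_{k, α} c_{k, β} d²k` for some
coefficients `g_{α β}` integrable over the Brillouin zone. -/
def NoKMixing (BZ : Set Vec) (H : Fock C.Site → Fock C.Site) : Prop :=
  ∃ g : C.Orbital → C.Orbital → Vec → ℂ,
    (∀ α β, IntegrableOn (g α β) BZ volume) ∧
    C.EqBZIntegral BZ H fun k φ ψ => ∑ α, ∑ β, g α β k * C.bilinearK k α β φ ψ

end Crystal

end TightBinding

end

/-! The Fourier transform over the Brillouin zone turns `k`-diagonal operators into operators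
invariant under magnetic lattice translations, and conversely. Everything therefore reduces to
asking when each Peierls amplitude is independent of the magnetic cell `i`.

If the amplitudes do not depend on `i`, orthogonality of the Bloch phases gives the stated kernel
(`integral_hop`, `eqBZIntegral_kernelForm`), and a kernel of this shape is an instance of absence of
`k`-mixing. Conversely, the matrix element of `c†_{k,α} c_{k,β}` between one-particle states sees
only the difference of their cells. Without `k`-mixing the amplitude of a hopping, which is such a
matrix element of the Hamiltonian because no hopping is listed twice, is then the same for all `i`
(`peierls_eq_of_noKMixing`).

For both potentials the Peierls phase is its value at `i = 0` plus `2π f(i)` with `f` additive in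
`i`, so invariance means that `f` is integer-valued (`integrality_iff_noKMixing`). For the linear
potential `f(i)` pairs `A T i` with the hopping vector, which is the condition on `S_hop`. The gauge
term replaces the hopping vector by its magnetic lattice part `T s` (`gauged_phase_eq`).
Connectedness makes the shifts `s` generate `ℤ²`, so the condition becomes integrality of `Tᵀ A T`
(`exists_int_matrix_iff`). -/

noncomputable section

namespace TightBinding

/-! ### The inner product and the operators on Fock space -/

section FockSpace

variable {S : Type}

/-- The inner product of Fock space as a sesquilinear map. -/
def Fock.innerSL : Fock S →ₗ⋆[ℂ] Fock S →ₗ[ℂ] ℂ :=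
  LinearMap.mk₂'ₛₗ (starRingEnd ℂ) (RingHom.id ℂ) Fock.inner
    (fun φ φ' ψ => by
      classical
      exact Finsupp.sum_add_index' (by simp) (by simp [add_mul]))
    (fun c φ ψ => by
      simp only [Fock.inner]
      rw [Finsupp.sum_smul_index' (by simp)]
      simp [Finsupp.sum, Finset.mul_sum, mul_assoc])
    (fun φ ψ ψ' => by simp [Fock.inner, mul_add, Finsupp.sum_add])
    (fun c φ ψ => by simp [Fock.inner, Finsupp.sum, Finset.mul_sum, mul_left_comm])

theorem Fock.innerSL_apply (φ ψ : Fock S) : Fock.innerSL φ ψ = Fock.inner φ ψ := rfl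

theorem Fock.inner_single_single [DecidableEq S] (F G : Finset S) (a b : ℂ) :
    Fock.inner (Finsupp.single F a) (Finsupp.single G b) = if F = G then conj a * b else 0 := by
  rw [Fock.inner, Finsupp.sum_single_index (by simp), Finsupp.single_apply]
  simp only [eq_comm (a := G), mul_ite, mul_zero]

variable [LinearOrder S]

theorem create_single (x : S) (F : Finset S) (a : ℂ) :
    create x (Finsupp.single F a) =
      if x ∈ F then 0 else Finsupp.single (insert x F) (a * fermionSign x F) := by
  rw [create, Finsupp.linearCombination_single]
  split_ifs <;> simp

theorem annihilate_single (x : S) (F : Finset S) (a : ℂ) :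
    annihilate x (Finsupp.single F a) =
      if x ∈ F then Finsupp.single (F.erase x) (a * fermionSign x F) else 0 := by
  rw [annihilate, Finsupp.linearCombination_single]
  split_ifs <;> simp

/-- The count is over sites strictly below `x`. Hence creation and annihilation at `x` carry the
same sign, which is what makes them adjoint. -/
theorem fermionSign_insert (x : S) (F : Finset S) :
    fermionSign x (insert x F) = fermionSign x F := by
  rw [fermionSign, fermionSign, Finset.filter_insert, if_neg (lt_irrefl x)]

theorem conj_fermionSign (x : S) (F : Finset S) : conj (fermionSign x F) = fermionSign x F := by
  simp [fermionSign]

theorem annihilate_one_particle (x y : S) :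
    annihilate x (Finsupp.single {y} 1) = if x = y then Finsupp.single ∅ 1 else 0 := by
  rw [annihilate_single]
  by_cases hxy : x = y
  · subst hxy
    simp [fermionSign, Finset.filter_singleton]
  · simp [hxy]

/-- `c†_x` is the adjoint of `c_x`. -/
theorem inner_create (x : S) (φ ψ : Fock S) :
    Fock.inner φ (create x ψ) = Fock.inner (annihilate x φ) ψ := by
  -- Both sides are sesquilinear, so comparing them on occupation-number states suffices.
  have key : (Fock.innerSL (S := S)).compl₂ (create x) =
      (Fock.innerSL (S := S)).comp (annihilate x) := by
    refine Finsupp.lhom_ext' fun F => LinearMap.ext fun a => ?_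
    refine Finsupp.lhom_ext' fun G => LinearMap.ext fun b => ?_
    simp only [LinearMap.comp_apply, LinearMap.compl₂_apply, Finsupp.lsingle_apply,
      Fock.innerSL_apply, create_single, annihilate_single]
    by_cases hF : x ∈ F <;> by_cases hG : x ∈ G
    · have : F.erase x ≠ G := fun h => Finset.notMem_erase x F (h ▸ hG)
      rw [if_pos hF, if_pos hG, Fock.inner_single_single, if_neg this]
      exact map_zero (Fock.innerSL _)
    · have : F.erase x = G ↔ F = insert x G :=
        ⟨fun h => by rw [← h, Finset.insert_erase hF], fun h => by
          rw [h, Finset.erase_insert hG]⟩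
      simp only [hF, hG, if_true, if_false, Fock.inner_single_single, this]
      split_ifs with h
      · rw [h, fermionSign_insert, map_mul, conj_fermionSign]
        ring
      · rfl
    · simp [hF, hG, Fock.inner]
    · have : F ≠ insert x G := fun h => hF (h ▸ Finset.mem_insert_self x G)
      simp [hF, hG, this, Fock.inner]
  exact LinearMap.congr_fun (LinearMap.congr_fun key φ) ψ

end FockSpace

/-! ### Fourier analysis on the Brillouin zone -/

namespace Crystal

variable {N M : ℕ} (C : Crystal N M)

theorem isUnit_det_V : IsUnit C.V.det := isUnit_iff_ne_zero.mpr C.V_pos.ne'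

theorem isUnit_det_Tr : IsUnit C.Tr.det := isUnit_iff_ne_zero.mpr C.Tr_det_ne

theorem det_Tr_pos : 0 < C.Tr.det := by
  have h : C.Tr.det = (C.T.det : ℝ) := (Int.cast_det C.T).symm
  rw [h]
  exact_mod_cast C.T_pos

theorem det_V_mul_det_Tr_pos : 0 < C.V.det * C.Tr.det := mul_pos C.V_pos C.det_Tr_pos

/-- The matrix whose columns are the reciprocal primitive vectors. -/
def reciprocalMatrix : Matrix (Fin 2) (Fin 2) ℝ := (2 * Real.pi) • ((C.Vᵀ)⁻¹ * (C.Trᵀ)⁻¹)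

theorem det_reciprocalMatrix :
    C.reciprocalMatrix.det = (2 * Real.pi) ^ 2 / (C.V.det * C.Tr.det) := by
  rw [reciprocalMatrix, det_smul, det_mul, det_nonsing_inv, det_nonsing_inv, det_transpose,
    det_transpose, Ring.inverse_eq_inv', Fintype.card_fin, div_eq_mul_inv, mul_inv]

theorem det_reciprocalMatrix_pos : 0 < C.reciprocalMatrix.det := by
  rw [det_reciprocalMatrix]
  have := C.det_V_mul_det_Tr_pos
  positivity

/-- The reciprocal primitive vectors. -/
def reciprocalBasis : Module.Basis (Fin 2) ℝ Vec :=
  (Pi.basisFun ℝ (Fin 2)).map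
    (C.reciprocalMatrix.toLinearEquiv' (C.reciprocalMatrix.invertibleOfIsUnitDet
      (isUnit_iff_ne_zero.mpr C.det_reciprocalMatrix_pos.ne')))

theorem reciprocalBasis_apply (a : Fin 2) : C.reciprocalBasis a = C.reciprocalMatrix.col a := by
  simp only [reciprocalBasis, Module.Basis.map_apply, Pi.basisFun_apply]
  change C.reciprocalMatrix *ᵥ _ = _
  simp

/-- As a `ℤ`-span of a basis, the lattice has the parallelepiped of that basis as a fundamental
domain, with which an arbitrary `BZ` can be compared. -/
theorem reciprocalLattice_eq :
    C.reciprocalLattice = (Submodule.span ℤ (Set.range C.reciprocalBasis)).toAddSubgroup := by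
  rw [Submodule.span_int_eq_addSubgroupClosure, reciprocalLattice]
  congr 2
  funext a
  rw [reciprocalBasis_apply]
  rfl

instance countable_reciprocalLattice : Countable C.reciprocalLattice := by
  rw [reciprocalLattice_eq]
  exact inferInstanceAs (Countable (Submodule.span ℤ (Set.range C.reciprocalBasis)))

theorem isAddFundamentalDomain_reciprocal :
    IsAddFundamentalDomain C.reciprocalLattice (ZSpan.fundamentalDomain C.reciprocalBasis)
      volume := by
  rw [reciprocalLattice_eq]
  exact ZSpan.isAddFundamentalDomain' _ _

theorem blochPhase_add_right (k k' : Vec) (i : IVec) :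
    C.blochPhase i (k + k') = C.blochPhase i k + C.blochPhase i k' := dotProduct_add _ _ _

theorem blochPhase_add_left (i i' : IVec) (k : Vec) :
    C.blochPhase (i + i') k = C.blochPhase i k + C.blochPhase i' k := by
  have : (i + i').toVec = i.toVec + i'.toVec := by funext a; simp [IVec.toVec]
  rw [blochPhase, this, mulVec_add, mulVec_add, add_dotProduct, ← blochPhase, ← blochPhase]

theorem blochPhase_neg_left (i : IVec) (k : Vec) :
    C.blochPhase (-i) k = -C.blochPhase i k := by
  have : (-i).toVec = -i.toVec := by funext a; simp [IVec.toVec]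
  rw [blochPhase, this, mulVec_neg, mulVec_neg, neg_dotProduct, ← blochPhase]

/-- Up to the factor `2π`, the reciprocal basis is dual to the columns of `V T`. -/
theorem blochPhase_reciprocalMatrix_mulVec (i : IVec) (x : Vec) :
    C.blochPhase i (C.reciprocalMatrix *ᵥ x) = 2 * Real.pi * (i.toVec ⬝ᵥ x) := by
  have h1 : (C.Tr)ᵀ * (C.Vᵀ * C.reciprocalMatrix) = (2 * Real.pi) • 1 := by
    have hV : IsUnit (C.Vᵀ).det := by rw [det_transpose]; exact C.isUnit_det_V
    have hT : IsUnit (C.Trᵀ).det := by rw [det_transpose]; exact C.isUnit_det_Tr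
    rw [reciprocalMatrix, mul_smul_comm, mul_nonsing_inv_cancel_left _ _ hV, mul_smul_comm,
      mul_nonsing_inv _ hT]
  rw [blochPhase, mulVec_mulVec, ← vecMul_transpose, ← dotProduct_mulVec, transpose_mul,
    mulVec_mulVec, Matrix.mul_assoc, h1, smul_mulVec, one_mulVec, dotProduct_smul, smul_eq_mul]

theorem exp_blochPhase_periodic (i : IVec) (g : C.reciprocalLattice) (k : Vec) :
    Complex.exp (Complex.I * (C.blochPhase i (g +ᵥ k) : ℂ)) =
      Complex.exp (Complex.I * (C.blochPhase i k : ℂ)) := by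
  have hg : ∀ v ∈ C.reciprocalLattice, ∃ n : ℤ, C.blochPhase i v = 2 * Real.pi * n := by
    intro v hv
    induction hv using AddSubgroup.closure_induction with
    | mem v hv =>
      obtain ⟨a, rfl⟩ := hv
      refine ⟨i a, ?_⟩
      have := C.blochPhase_reciprocalMatrix_mulVec i (Pi.single a 1)
      rw [mulVec_single_one] at this
      refine this.trans ?_
      simp [IVec.toVec]
    | zero => exact ⟨0, by simp [blochPhase]⟩
    | add v w _ _ hv hw =>
      obtain ⟨n, hn⟩ := hv
      obtain ⟨n', hn'⟩ := hw
      exact ⟨n + n', by rw [blochPhase_add_right, hn, hn']; push_cast; ring⟩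
    | neg v _ hv =>
      obtain ⟨n, hn⟩ := hv
      exact ⟨-n, by rw [blochPhase, dotProduct_neg, ← blochPhase, hn]; push_cast; ring⟩
  obtain ⟨n, hn⟩ := hg g g.2
  rw [AddSubgroup.vadd_def, vadd_eq_add, blochPhase_add_right, hn]
  rw [Complex.exp_eq_exp_iff_exists_int]
  exact ⟨n, by push_cast; ring⟩

theorem continuous_exp_blochPhase (i : IVec) :
    Continuous fun k => Complex.exp (Complex.I * (C.blochPhase i k : ℂ)) := by
  unfold blochPhase dotProduct
  fun_prop

/-! ### Integrals over the Brillouin zone -/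

variable {C} {BZ : Set Vec}

/-- All fundamental domains have the same volume, so it can be read off from the determinant of the
reciprocal basis. -/
theorem volume_brillouinZone (hBZ : IsAddFundamentalDomain C.reciprocalLattice BZ volume) :
    volume BZ = ENNReal.ofReal ((2 * Real.pi) ^ 2 / (C.V.det * C.Tr.det)) := by
  rw [hBZ.measure_eq C.isAddFundamentalDomain_reciprocal, ZSpan.volume_fundamentalDomain]
  have : Matrix.of C.reciprocalBasis = C.reciprocalMatrixᵀ := by
    ext a b
    rw [of_apply, reciprocalBasis_apply]
    rfl
  rw [this, det_transpose, abs_of_pos C.det_reciprocalMatrix_pos, det_reciprocalMatrix]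

theorem siteSrc_injective (j : C.J) (m : Fin M) :
    Function.Injective fun i => C.siteSrc i j m := fun _ _ e => congrArg Site.cell e

theorem siteTgt_injective (j : C.J) (m : Fin M) :
    Function.Injective fun i => C.siteTgt i j m :=
  fun _ _ e => add_right_cancel (congrArg Site.cell e)

theorem exp_phase_eq (s : IVec) (k : Vec) (x : ℝ) :
    Complex.exp (Complex.I * ((-C.blochPhase s k + x : ℝ) : ℂ)) =
      Complex.exp (Complex.I * (x : ℂ)) *
        Complex.exp (Complex.I * (C.blochPhase (-s) k : ℂ)) := by
  rw [← Complex.exp_add, blochPhase_neg_left]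
  congr 1
  push_cast
  ring

theorem conj_exp_phase_eq (s : IVec) (k : Vec) (x : ℝ) :
    conj (Complex.exp (Complex.I * ((-C.blochPhase s k + x : ℝ) : ℂ))) =
      conj (Complex.exp (Complex.I * (x : ℂ))) *
        Complex.exp (Complex.I * (C.blochPhase s k : ℂ)) := by
  rw [← Complex.exp_conj, ← Complex.exp_conj, ← Complex.exp_add]
  congr 1
  simp
  ring

/-- A bounded continuous function is integrable over the Brillouin zone. -/
theorem integrableOn_brillouinZone (hBZ : IsAddFundamentalDomain C.reciprocalLattice BZ volume)
    {f : Vec → ℂ} (hf : Continuous f) {c : ℝ} (hc : ∀ k, ‖f k‖ ≤ c) : IntegrableOn f BZ volume :=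
  Measure.integrableOn_of_bounded (M := c) (by rw [volume_brillouinZone hBZ]; simp)
    hf.aestronglyMeasurable (Filter.Eventually.of_forall hc)

theorem integrableOn_exp_blochPhase
    (hBZ : IsAddFundamentalDomain C.reciprocalLattice BZ volume) (i : IVec) :
    IntegrableOn (fun k => Complex.exp (Complex.I * (C.blochPhase i k : ℂ))) BZ volume :=
  integrableOn_brillouinZone hBZ (C.continuous_exp_blochPhase i) (c := 1) fun k => by
    rw [mul_comm, Complex.norm_exp_ofReal_mul_I]

open scoped Pointwise in
/-- Orthogonality of the Bloch phases. -/
theorem integral_exp_blochPhase (hBZ : IsAddFundamentalDomain C.reciprocalLattice BZ volume)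
    (i : IVec) :
    ∫ k in BZ, Complex.exp (Complex.I * (C.blochPhase i k : ℂ)) =
      if i = 0 then (((2 * Real.pi) ^ 2 / (C.V.det * C.Tr.det) : ℝ) : ℂ) else 0 := by
  have hpos := C.det_V_mul_det_Tr_pos
  split_ifs with hi
  · subst hi
    have : ∀ k, C.blochPhase 0 k = 0 := fun k => by simp [blochPhase, IVec.toVec]
    simp only [this, Complex.ofReal_zero, mul_zero, Complex.exp_zero, setIntegral_const]
    rw [measureReal_def, volume_brillouinZone hBZ, ENNReal.toReal_ofReal (by positivity)]
    simp
  · obtain ⟨a, ha⟩ := Function.ne_iff.mp hi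
    have ha' : (i a : ℝ) ≠ 0 := by exact_mod_cast ha
    -- Half a period: translation by `v` multiplies the Bloch phase by `exp (iπ) = -1`. The
    -- translate of `BZ` is again a fundamental domain, so the integral equals its own negative.
    set v : Vec := C.reciprocalMatrix *ᵥ Pi.single a (1 / (2 * i a)) with hv
    have hphase : C.blochPhase i v = Real.pi := by
      rw [hv, blochPhase_reciprocalMatrix_mulVec]
      simp [IVec.toVec]
      field_simp
    have hBZ' : IsAddFundamentalDomain C.reciprocalLattice (v +ᵥ BZ) volume := hBZ.vadd_of_comm v
    have h1 := hBZ.setIntegral_eq hBZ' (f := fun k =>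
      Complex.exp (Complex.I * (C.blochPhase i k : ℂ))) (C.exp_blochPhase_periodic i)
    have h2 : ∫ k in v +ᵥ BZ, Complex.exp (Complex.I * (C.blochPhase i k : ℂ)) =
        ∫ k in BZ, Complex.exp (Complex.I * (C.blochPhase i (v + k) : ℂ)) :=
      (measurePreserving_add_left volume v).setIntegral_image_emb
        (measurableEmbedding_addLeft v) _ _
    have h3 : ∀ k, Complex.exp (Complex.I * (C.blochPhase i (v + k) : ℂ)) =
        -Complex.exp (Complex.I * (C.blochPhase i k : ℂ)) := fun k => by
      rw [blochPhase_add_right, hphase, Complex.ofReal_add, mul_add, Complex.exp_add,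
        mul_comm Complex.I, Complex.exp_pi_mul_I, neg_one_mul]
    rw [h2] at h1
    simp only [h3, integral_neg] at h1
    exact self_eq_neg.mp h1

end Crystal

/-! ### Matrix elements of the Hamiltonian -/

namespace Crystal

variable {N M : ℕ} {C : Crystal N M} [LinearOrder C.Site] {BZ : Set Vec}

/-- `U` and `U'` may be any finite sets containing the cells that contribute; singletons are used
later for one-particle states. The prefactor is the square of the normalisation of `c_k`. -/
theorem bilinearK_eq_sum (k : Vec) (α β : C.Orbital) (φ ψ : Fock C.Site)
    {U U' : Finset IVec} (hU : ∀ i, annihilate (⟨i, α⟩ : C.Site) φ ≠ 0 → i ∈ U)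
    (hU' : ∀ i, annihilate (⟨i, β⟩ : C.Site) ψ ≠ 0 → i ∈ U') :
    C.bilinearK k α β φ ψ = ((C.V.det * C.Tr.det / (2 * Real.pi) ^ 2 : ℝ) : ℂ) *
      ∑ i' ∈ U', ∑ i ∈ U,
        Complex.exp (Complex.I * (C.blochPhase (i - i') k : ℂ)) *
          Fock.inner (annihilate (⟨i, α⟩ : C.Site) φ) (annihilate (⟨i', β⟩ : C.Site) ψ) := by
  have hsum : ∀ (γ : C.Orbital) (χ : Fock C.Site) (W : Finset IVec),
      (∀ i, annihilate (⟨i, γ⟩ : C.Site) χ ≠ 0 → i ∈ W) → C.annihilateK k γ χ =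
        ((Real.sqrt (C.V.det * C.Tr.det) / (2 * Real.pi) : ℝ) : ℂ) • ∑ i ∈ W,
          Complex.exp (-Complex.I * (C.blochPhase i k : ℂ)) • annihilate (⟨i, γ⟩ : C.Site) χ := by
    intro γ χ W hW
    rw [annihilateK, finsum_eq_sum_of_support_subset]
    intro i hi
    exact hW i fun h0 => hi (by simp [h0])
  have hsq : (Real.sqrt (C.V.det * C.Tr.det) / (2 * Real.pi)) *
      (Real.sqrt (C.V.det * C.Tr.det) / (2 * Real.pi)) =
        C.V.det * C.Tr.det / (2 * Real.pi) ^ 2 := by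
    rw [div_mul_div_comm, Real.mul_self_sqrt C.det_V_mul_det_Tr_pos.le, sq]
  rw [bilinearK, hsum α φ U hU, hsum β ψ U' hU', ← Fock.innerSL_apply, ← hsq]
  simp only [LinearMap.map_smulₛₗ, map_sum, LinearMap.smul_apply, LinearMap.sum_apply, map_smul,
    smul_eq_mul, Fock.innerSL_apply, Complex.conj_ofReal, Complex.ofReal_mul]
  rw [Finset.mul_sum, Finset.mul_sum]
  refine Finset.sum_congr rfl fun i' _ => ?_
  rw [mul_left_comm (Complex.exp _), ← mul_assoc]
  congr 1
  rw [Finset.mul_sum]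
  refine Finset.sum_congr rfl fun i _ => ?_
  have hphase : C.blochPhase (i - i') k =
      C.blochPhase i k - C.blochPhase i' k := by
    rw [sub_eq_add_neg, blochPhase_add_left, blochPhase_neg_left, sub_eq_add_neg]
  rw [hphase, ← Complex.exp_conj, ← mul_assoc]
  rw [mul_comm (Complex.exp _), ← Complex.exp_add]
  congr 2
  simp
  ring

theorem finite_annihilate_cell (α : C.Orbital) (ψ : Fock C.Site) :
    {i : IVec | annihilate (⟨i, α⟩ : C.Site) ψ ≠ 0}.Finite :=
  (finite_annihilate_ne_zero ψ).preimage (f := fun i : IVec => (⟨i, α⟩ : C.Site))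
    fun _ _ _ _ e => congrArg Site.cell e

/-- Orthogonality keeps only the pairs of cells that differ by `s`, and the prefactor of `bilinearK`
is the reciprocal of the volume of the Brillouin zone. Thus a Bloch phase in the coefficient becomes
a translation by `s` in real space. -/
theorem integrableOn_exp_mul_bilinearK
    (hBZ : IsAddFundamentalDomain C.reciprocalLattice BZ volume) (s : IVec) (α β : C.Orbital)
    (φ ψ : Fock C.Site) :
    IntegrableOn (fun k => Complex.exp (Complex.I * (C.blochPhase s k : ℂ)) *
      C.bilinearK k α β φ ψ) BZ volume ∧
    ∫ k in BZ, Complex.exp (Complex.I * (C.blochPhase s k : ℂ)) * C.bilinearK k α β φ ψ =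
      ∑ᶠ i, Fock.inner (annihilate (⟨i - s, α⟩ : C.Site) φ) (annihilate (⟨i, β⟩ : C.Site) ψ) := by
  set U := (finite_annihilate_cell α φ).toFinset with hU
  set U' := (finite_annihilate_cell β ψ).toFinset with hU'
  have hfun : ∀ k, Complex.exp (Complex.I * (C.blochPhase s k : ℂ)) * C.bilinearK k α β φ ψ =
      ((C.V.det * C.Tr.det / (2 * Real.pi) ^ 2 : ℝ) : ℂ) * ∑ i' ∈ U', ∑ i ∈ U,
        Complex.exp (Complex.I * (C.blochPhase (s + (i - i')) k : ℂ)) *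
          Fock.inner (annihilate (⟨i, α⟩ : C.Site) φ) (annihilate (⟨i', β⟩ : C.Site) ψ) := by
    intro k
    rw [bilinearK_eq_sum k α β φ ψ (U := U) (U' := U') (by simp [hU]) (by simp [hU']),
      mul_left_comm, Finset.mul_sum]
    congr 1
    refine Finset.sum_congr rfl fun i' _ => ?_
    rw [Finset.mul_sum]
    refine Finset.sum_congr rfl fun i _ => ?_
    rw [← mul_assoc, ← Complex.exp_add, ← mul_add, ← Complex.ofReal_add, ← blochPhase_add_left]
  have hint : ∀ i' ∈ U', ∀ i ∈ U, IntegrableOn (fun k =>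
      Complex.exp (Complex.I * (C.blochPhase (s + (i - i')) k : ℂ)) *
        Fock.inner (annihilate (⟨i, α⟩ : C.Site) φ) (annihilate (⟨i', β⟩ : C.Site) ψ)) BZ volume :=
    fun i' _ i _ => (integrableOn_exp_blochPhase hBZ _).mul_const _
  simp only [hfun]
  refine ⟨(integrable_finsetSum _ fun i' hi' => integrable_finsetSum _ (hint i' hi')).const_mul _,
    ?_⟩
  have hpos := C.det_V_mul_det_Tr_pos
  rw [integral_const_mul,
    integral_finsetSum _ fun i' hi' => integrable_finsetSum _ (hint i' hi'),
    finsum_eq_sum_of_support_subset (s := U'), Finset.mul_sum]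
  · refine Finset.sum_congr rfl fun i' hi' => ?_
    rw [integral_finsetSum _ (hint i' hi')]
    simp only [integral_mul_const, integral_exp_blochPhase hBZ]
    rw [Finset.sum_eq_single (i' - s)]
    · rw [if_pos (by abel), ← mul_assoc, ← Complex.ofReal_mul, div_mul_div_cancel₀ (by positivity),
        div_self hpos.ne', Complex.ofReal_one, one_mul]
    · intro i _ hi
      rw [if_neg, zero_mul]
      intro h0
      exact hi (by rw [← sub_eq_zero, ← h0]; abel)
    · intro hi
      have : annihilate (⟨i' - s, α⟩ : C.Site) φ = 0 := by simpa [hU] using hi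
      simp [this, Fock.inner]
  · intro i hi
    simp only [hU', Set.Finite.coe_toFinset, Set.mem_ofPred_eq]
    intro h0
    exact hi (by simp only [h0]; exact map_zero (Fock.innerSL _))

theorem inner_hamiltonian (h q : ℝ) (a : VectorPotential) (φ ψ : Fock C.Site) :
    Fock.inner φ (C.hamiltonian h q a ψ) = -∑ᶠ i, ∑ j, ∑ m,
      (C.peierls h q a i j m *
          Fock.inner (annihilate (C.siteTgt i j m) φ) (annihilate (C.siteSrc i j m) ψ)
        + conj (C.peierls h q a i j m) *
          Fock.inner (annihilate (C.siteSrc i j m) φ) (annihilate (C.siteTgt i j m) ψ)) := by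
  rw [hamiltonian, ← Fock.innerSL_apply, map_neg, ← LinearMap.toAddMonoidHom_coe,
    AddMonoidHom.map_finsum _ (C.finite_support_hamiltonian h q a ψ)]
  simp only [LinearMap.toAddMonoidHom_coe, map_sum, hopTerm, map_add, map_smul, smul_eq_mul,
    Fock.innerSL_apply, inner_create]

/-! ### Translation-invariant amplitudes have no `k`-mixing -/

theorem finite_support_inner_annihilate (f : IVec → C.Site) (g : IVec → C.Site)
    (hg : Function.Injective g) (φ ψ : Fock C.Site) (c : ℂ) :
    (Function.support fun i =>
      c * Fock.inner (annihilate (f i) φ) (annihilate (g i) ψ)).Finite := by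
  refine ((finite_annihilate_ne_zero ψ).preimage hg.injOn).subset fun i hi h0 => hi ?_
  simp only [h0]
  rw [← Fock.innerSL_apply, map_zero, mul_zero]

/-- One hopping with translation-invariant amplitude `c`, in momentum space. -/
theorem integral_hop (hBZ : IsAddFundamentalDomain C.reciprocalLattice BZ volume) (j : C.J)
    (m : Fin M) (c : ℂ) (φ ψ : Fock C.Site) :
    IntegrableOn (fun k =>
      c * (Complex.exp (Complex.I * (C.blochPhase (-C.shift j m) k : ℂ)) *
          C.bilinearK k (C.orbTgt j m) (C.orbSrc j m) φ ψ)
        + conj c * (Complex.exp (Complex.I * (C.blochPhase (C.shift j m) k : ℂ)) *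
          C.bilinearK k (C.orbSrc j m) (C.orbTgt j m) φ ψ)) BZ volume ∧
    ∫ k in BZ,
      (c * (Complex.exp (Complex.I * (C.blochPhase (-C.shift j m) k : ℂ)) *
          C.bilinearK k (C.orbTgt j m) (C.orbSrc j m) φ ψ)
        + conj c * (Complex.exp (Complex.I * (C.blochPhase (C.shift j m) k : ℂ)) *
          C.bilinearK k (C.orbSrc j m) (C.orbTgt j m) φ ψ)) =
    ∑ᶠ i,
      (c * Fock.inner (annihilate (C.siteTgt i j m) φ) (annihilate (C.siteSrc i j m) ψ)
        + conj c *
          Fock.inner (annihilate (C.siteSrc i j m) φ) (annihilate (C.siteTgt i j m) ψ)) := by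
  have h1 := integrableOn_exp_mul_bilinearK hBZ (-C.shift j m) (C.orbTgt j m) (C.orbSrc j m) φ ψ
  have h2 := integrableOn_exp_mul_bilinearK hBZ (C.shift j m) (C.orbSrc j m) (C.orbTgt j m) φ ψ
  refine ⟨(h1.1.const_mul _).add (h2.1.const_mul _), ?_⟩
  rw [integral_add (h1.1.const_mul _) (h2.1.const_mul _), integral_const_mul, integral_const_mul,
    h1.2, h2.2, finsum_add_distrib
      (finite_support_inner_annihilate (fun i => C.siteTgt i j m) (fun i => C.siteSrc i j m)
        (siteSrc_injective j m) φ ψ c)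
      (finite_support_inner_annihilate (fun i => C.siteSrc i j m) (fun i => C.siteTgt i j m)
        (siteTgt_injective j m) φ ψ (conj c)), mul_finsum, mul_finsum]
  congr 1
  · refine finsum_congr fun i => ?_
    rw [sub_neg_eq_add]
    rfl
  -- The reverse hop comes out indexed by its cell `i + s`; reindexing labels it by the cell where
  -- the forward hop starts.
  · rw [← finsum_comp_equiv (Equiv.addRight (C.shift j m))]
    refine finsum_congr fun i => ?_
    rw [Equiv.coe_addRight, add_sub_cancel_right]
    rfl

theorem kernelForm_eq (θ : C.J → Fin M → ℝ) (k : Vec) (φ ψ : Fock C.Site) :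
    C.kernelForm (fun j m => -C.blochPhase (C.shift j m) k + θ j m) k φ ψ = -∑ j, ∑ m,
      (C.t m * Complex.exp (Complex.I * (θ j m : ℂ)) *
          (Complex.exp (Complex.I * (C.blochPhase (-C.shift j m) k : ℂ)) *
            C.bilinearK k (C.orbTgt j m) (C.orbSrc j m) φ ψ)
        + conj (C.t m * Complex.exp (Complex.I * (θ j m : ℂ))) *
          (Complex.exp (Complex.I * (C.blochPhase (C.shift j m) k : ℂ)) *
            C.bilinearK k (C.orbSrc j m) (C.orbTgt j m) φ ψ)) := by
  rw [kernelForm, neg_inj]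
  refine Finset.sum_congr rfl fun j _ => Finset.sum_congr rfl fun m _ => ?_
  rw [map_mul, map_mul, conj_exp_phase_eq, exp_phase_eq]
  ring

/-- Here `θ` does not depend on `i`, so `integral_hop` applies to each hopping separately. The
finiteness facts only serve to exchange the sum over cells with the sums over `j` and `m`. -/
theorem eqBZIntegral_kernelForm
    (hBZ : IsAddFundamentalDomain C.reciprocalLattice BZ volume) {h q : ℝ} {a : VectorPotential}
    {θ : C.J → Fin M → ℝ}
    (hθ : ∀ i j m, C.peierls h q a i j m = C.t m * Complex.exp (Complex.I * (θ j m : ℂ))) :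
    C.EqBZIntegral BZ (C.hamiltonian h q a)
      fun k => C.kernelForm (fun j m => -C.blochPhase (C.shift j m) k + θ j m) k := by
  intro φ ψ
  simp only [kernelForm_eq]
  have hI := fun j m =>
    integral_hop hBZ j m (C.t m * Complex.exp (Complex.I * (θ j m : ℂ))) φ ψ
  have hi := fun j => integrable_finsetSum Finset.univ fun m _ => (hI j m).1
  refine ⟨(integrable_finsetSum Finset.univ fun j _ => hi j).neg, ?_⟩
  rw [inner_hamiltonian, integral_neg, integral_finsetSum _ fun j _ => hi j, neg_inj]
  have hf := fun j m => ((finite_support_inner_annihilate (fun i => C.siteTgt i j m)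
      (fun i => C.siteSrc i j m) (siteSrc_injective j m) φ ψ
        (C.t m * Complex.exp (Complex.I * (θ j m : ℂ)))).union
    (finite_support_inner_annihilate (fun i => C.siteSrc i j m)
      (fun i => C.siteTgt i j m) (siteTgt_injective j m) φ ψ
        (conj (C.t m * Complex.exp (Complex.I * (θ j m : ℂ)))))).subset
      (Function.support_add _ _)
  simp only [hθ]
  rw [finsum_sum_comm]
  swap
  · intro j _
    refine (Set.finite_iUnion fun m => hf j m).subset fun i hi => ?_
    by_contra hcon
    simp only [Set.mem_iUnion, not_exists, Function.notMem_support] at hcon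
    exact hi (Finset.sum_eq_zero fun m _ => hcon m)
  refine Finset.sum_congr rfl fun j _ => ?_
  rw [finsum_sum_comm _ _ fun m _ => hf j m, integral_finsetSum _ fun m _ => (hI j m).1]
  exact Finset.sum_congr rfl fun m _ => (hI j m).2.symm

theorem noKMixing_of_eqBZIntegral_kernelForm
    (hBZ : IsAddFundamentalDomain C.reciprocalLattice BZ volume) {H : Fock C.Site → Fock C.Site}
    {θ : C.J → Fin M → ℝ}
    (hH : C.EqBZIntegral BZ H
      fun k => C.kernelForm (fun j m => -C.blochPhase (C.shift j m) k + θ j m) k) :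
    C.NoKMixing BZ H := by
  classical
  -- Distinct hoppings may join the same pair of orbitals, so the coefficient of a pair is a sum
  -- over all `j` and `m`, selected by indicators.
  set g : C.Orbital → C.Orbital → Vec → ℂ := fun α β k => -∑ j, ∑ m,
    ((if α = C.orbTgt j m ∧ β = C.orbSrc j m then C.t m * Complex.exp (Complex.I *
        ((-C.blochPhase (C.shift j m) k + θ j m : ℝ) : ℂ)) else 0) +
      (if α = C.orbSrc j m ∧ β = C.orbTgt j m then conj (C.t m * Complex.exp (Complex.I *
        ((-C.blochPhase (C.shift j m) k + θ j m : ℝ) : ℂ))) else 0)) with hg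
  refine ⟨g, fun α β => ?_, ?_⟩
  · refine (integrable_finsetSum _ fun j _ => integrable_finsetSum _ fun m _ => ?_).neg
    refine Integrable.add ?_ ?_
    · split_ifs
      · simp only [exp_phase_eq, ← mul_assoc]
        exact (integrableOn_exp_blochPhase hBZ _).const_mul _
      · exact integrable_zero _ _ _
    · split_ifs
      · simp only [map_mul, conj_exp_phase_eq, ← mul_assoc]
        exact (integrableOn_exp_blochPhase hBZ _).const_mul _
      · exact integrable_zero _ _ _
  · have hform : ∀ k φ ψ, ∑ α, ∑ β, g α β k * C.bilinearK k α β φ ψ =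
        C.kernelForm (fun j m => -C.blochPhase (C.shift j m) k + θ j m) k φ ψ := by
      intro k φ ψ
      simp only [kernelForm, hg, neg_mul, Finset.sum_mul, Finset.sum_neg_distrib, neg_inj]
      simp_rw [Finset.sum_comm (s := (Finset.univ : Finset C.Orbital))
        (t := (Finset.univ : Finset C.J))]
      refine Finset.sum_congr rfl fun j _ => ?_
      simp_rw [Finset.sum_comm (s := (Finset.univ : Finset C.Orbital))
        (t := (Finset.univ : Finset (Fin M)))]
      refine Finset.sum_congr rfl fun m _ => ?_
      simp only [add_mul, Finset.sum_add_distrib, ite_mul, zero_mul, ite_and]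
      simp
    intro φ ψ
    simpa only [hform] using hH φ ψ

end Crystal

/-! ### Absence of `k`-mixing forces translation-invariant amplitudes -/

namespace Crystal

variable {N M : ℕ} {C : Crystal N M}

/-- The unit cell of a site. -/
def Site.unitCell (x : C.Site) : IVec := C.T *ᵥ x.cell + x.orb.1.1

theorem unitCell_siteSrc (i : IVec) (j : C.J) (m : Fin M) :
    (C.siteSrc i j m).unitCell = C.T *ᵥ i + j.1 := rfl

theorem unitCell_siteTgt (i : IVec) (j : C.J) (m : Fin M) :
    (C.siteTgt i j m).unitCell = C.T *ᵥ i + j.1 + C.Δ m := by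
  change C.T *ᵥ (i + C.shift j m) + (j.1 + C.Δ m - C.T *ᵥ C.shift j m) = _
  rw [mulVec_add]
  abel

theorem eq_of_siteSrc_eq {i i' : IVec} {j j' : C.J} {m m' : Fin M}
    (e : C.siteSrc i' j' m' = C.siteSrc i j m) : i' = i ∧ j' = j ∧ C.src m' = C.src m :=
  ⟨congrArg Site.cell e, congrArg (fun x => x.orb.1) e, congrArg (fun x => x.orb.2) e⟩

/-- By `hop_inj`, a hopping is determined by its end sites, so a matrix element between these
isolates a single amplitude. -/
theorem eq_of_hop_eq {i i' : IVec} {j j' : C.J} {m m' : Fin M}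
    (h1 : C.siteTgt i' j' m' = C.siteTgt i j m) (h2 : C.siteSrc i' j' m' = C.siteSrc i j m) :
    i' = i ∧ j' = j ∧ m' = m := by
  obtain ⟨rfl, rfl, hsrc⟩ := eq_of_siteSrc_eq h2
  refine ⟨rfl, rfl, C.hop_inj m' m hsrc (congrArg (fun x => x.orb.2) h1) ?_⟩
  have := congrArg Site.unitCell h1
  simpa only [unitCell_siteTgt, add_right_inj] using this

/-- By `hop_inj_rev`, a hopping that reverses another must be that hopping itself, and then `Δ =
-Δ`. -/
theorem onsite_of_hop_eq_reverse {i i' : IVec} {j j' : C.J} {m m' : Fin M}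
    (h1 : C.siteSrc i' j' m' = C.siteTgt i j m) (h2 : C.siteTgt i' j' m' = C.siteSrc i j m) :
    C.src m = C.tgt m ∧ C.Δ m = 0 := by
  have hs : C.src m' = C.tgt m := congrArg (fun x => x.orb.2) h1
  have ht : C.tgt m' = C.src m := congrArg (fun x => x.orb.2) h2
  have e1 := congrArg Site.unitCell h1
  have e2 := congrArg Site.unitCell h2
  rw [unitCell_siteTgt, unitCell_siteSrc] at e1 e2
  have hΔ : C.Δ m' = -C.Δ m := by
    rw [e1, add_assoc, add_eq_left] at e2
    exact (neg_eq_of_add_eq_zero_right e2).symm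
  obtain rfl := C.hop_inj_rev m' m hs ht hΔ
  exact ⟨hs, self_eq_neg.mp hΔ⟩

/-! ### One-particle matrix elements -/

variable [LinearOrder C.Site] {BZ : Set Vec}

theorem inner_annihilate_one_particle (x y z w : C.Site) :
    Fock.inner (annihilate x (Finsupp.single {z} 1)) (annihilate y (Finsupp.single {w} 1)) =
      if x = z ∧ y = w then 1 else 0 := by
  rw [annihilate_one_particle, annihilate_one_particle]
  by_cases hx : x = z <;> by_cases hy : y = w <;> simp [hx, hy, Fock.inner]

/-- The one-particle matrix element of the Hamiltonian between the ends of a hopping. -/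
theorem inner_hamiltonian_one_particle (h q : ℝ) (a : VectorPotential) (i : IVec) (j : C.J)
    (m : Fin M) (hm : ¬(C.src m = C.tgt m ∧ C.Δ m = 0)) :
    Fock.inner (Finsupp.single {C.siteTgt i j m} 1)
      (C.hamiltonian h q a (Finsupp.single {C.siteSrc i j m} 1)) = -C.peierls h q a i j m := by
  -- No Hermitian-conjugate term contributes. For an on-site hopping it would, leaving only the
  -- amplitude plus its conjugate.
  have hrev : ∀ i' j' m',
      ¬(C.siteSrc i' j' m' = C.siteTgt i j m ∧ C.siteTgt i' j' m' = C.siteSrc i j m) :=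
    fun _ _ _ e => hm (onsite_of_hop_eq_reverse e.1 e.2)
  simp only [inner_hamiltonian, inner_annihilate_one_particle, hrev, if_false, mul_zero, add_zero,
    mul_ite, mul_one]
  rw [finsum_eq_single _ i, Finset.sum_eq_single j, Finset.sum_eq_single m]
  · simp
  · exact fun m' _ hm' => if_neg fun e => hm' (eq_of_hop_eq e.1 e.2).2.2
  · simp
  · exact fun j' _ hj' => Finset.sum_eq_zero fun m' _ =>
      if_neg fun e => hj' (eq_of_hop_eq e.1 e.2).2.1
  · simp
  · exact fun i' hi' => Finset.sum_eq_zero fun j' _ => Finset.sum_eq_zero fun m' _ =>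
      if_neg fun e => hi' (eq_of_hop_eq e.1 e.2).1

theorem bilinearK_one_particle (k : Vec) (α β : C.Orbital) (x y : C.Site) :
    C.bilinearK k α β (Finsupp.single {x} 1) (Finsupp.single {y} 1) =
      if α = x.orb ∧ β = y.orb then ((C.V.det * C.Tr.det / (2 * Real.pi) ^ 2 : ℝ) : ℂ) *
        Complex.exp (Complex.I * (C.blochPhase (x.cell - y.cell) k : ℂ)) else 0 := by
  have hcell : ∀ (γ : C.Orbital) (z : C.Site) (i : IVec),
      annihilate (⟨i, γ⟩ : C.Site) (Finsupp.single {z} (1 : ℂ)) ≠ 0 →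
        i ∈ ({z.cell} : Finset IVec) := by
    intro γ z i hi
    rw [annihilate_one_particle] at hi
    by_contra hne
    exact hi (if_neg fun e => hne (by rw [← e]; simp))
  rw [bilinearK_eq_sum k α β _ _ (hcell α x) (hcell β y)]
  simp only [Finset.sum_singleton, inner_annihilate_one_particle, Site.ext_iff, true_and, mul_ite,
    mul_one, mul_zero]

/-- Without `k`-mixing, the one-particle matrix elements are invariant under translations of the
magnetic lattice. -/
theorem peierls_eq_of_noKMixing {h q : ℝ} {a : VectorPotential}
    (hK : C.NoKMixing BZ (C.hamiltonian h q a)) (i : IVec) (j : C.J) (m : Fin M)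
    (hm : ¬(C.src m = C.tgt m ∧ C.Δ m = 0)) :
    C.peierls h q a i j m = C.peierls h q a 0 j m := by
  obtain ⟨g, -, hH⟩ := hK
  -- The integrand on the right does not contain `i'`: only one pair of orbitals survives, and its
  -- phase depends on the cells through their difference `shift j m`.
  have key : ∀ i', -C.peierls h q a i' j m = ∫ k in BZ, g (C.orbTgt j m) (C.orbSrc j m) k *
      (((C.V.det * C.Tr.det / (2 * Real.pi) ^ 2 : ℝ) : ℂ) *
        Complex.exp (Complex.I * (C.blochPhase (C.shift j m) k : ℂ))) := by
    intro i'
    rw [← inner_hamiltonian_one_particle h q a i' j m hm, (hH _ _).2]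
    refine integral_congr_ae (Filter.Eventually.of_forall fun k => ?_)
    simp only [bilinearK_one_particle]
    have hs : (C.siteTgt i' j m).cell - (C.siteSrc i' j m).cell = C.shift j m :=
      add_sub_cancel_left i' _
    rw [Finset.sum_eq_single (C.orbTgt j m), Finset.sum_eq_single (C.orbSrc j m), hs]
    · rw [if_pos ⟨rfl, rfl⟩]
    · exact fun β _ hβ => by rw [if_neg fun e => hβ e.2, mul_zero]
    · simp
    · exact fun α _ hα => Finset.sum_eq_zero fun β _ => by rw [if_neg fun e => hα e.1, mul_zero]
    · simp
  exact neg_inj.mp ((key i).trans (key 0).symm)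

/-- If the Peierls phase from magnetic unit cell `i` exceeds `θ` by `2π` times an additive
function `f` of `i`, then integrality of `f` decides whether `k` is mixed. -/
theorem integrality_iff_noKMixing
    (hBZ : IsAddFundamentalDomain C.reciprocalLattice BZ volume) {h q : ℝ} {a : VectorPotential}
    {θ : C.J → Fin M → ℝ} {f : C.J → Fin M → IVec → ℝ} {P : Prop} {Hk : Vec → C.J → Fin M → ℝ}
    (hp : ∀ i j m, C.peierls h q a i j m =
      C.t m * Complex.exp (Complex.I * ((θ j m + 2 * Real.pi * f j m i : ℝ) : ℂ)))
    (hHk : ∀ k j m, Hk k j m = -C.blochPhase (C.shift j m) k + θ j m)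
    (hf0 : ∀ j m, f j m 0 = 0)
    (hf : ∀ j m, C.src m = C.tgt m → C.Δ m = 0 → ∀ i, f j m i = 0)
    (hP : P ↔ ∀ j m i, ∃ n : ℤ, f j m i = n) :
    (P ↔ C.NoKMixing BZ (C.hamiltonian h q a)) ∧
      (P ↔ C.EqBZIntegral BZ (C.hamiltonian h q a) fun k => C.kernelForm (Hk k) k) := by
  have hHk' : Hk = fun k j m => -C.blochPhase (C.shift j m) k + θ j m := by
    funext k j m
    exact hHk k j m
  subst hHk'
  have h1 : P → C.EqBZIntegral BZ (C.hamiltonian h q a)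
      fun k => C.kernelForm (fun j m => -C.blochPhase (C.shift j m) k + θ j m) k := by
    intro hint
    refine eqBZIntegral_kernelForm hBZ fun i j m => ?_
    obtain ⟨n, hn⟩ := hP.mp hint j m i
    rw [hp, hn]
    congr 1
    rw [Complex.exp_eq_exp_iff_exists_int]
    exact ⟨n, by push_cast; ring⟩
  have h2 : C.NoKMixing BZ (C.hamiltonian h q a) → P := by
    refine fun hK => hP.mpr fun j m i => ?_
    -- On-site amplitudes cannot be read off from matrix elements, but there `f` vanishes by `hf`.
    by_cases hm : C.src m = C.tgt m ∧ C.Δ m = 0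
    · exact ⟨0, by rw [hf j m hm.1 hm.2 i, Int.cast_zero]⟩
    · have := peierls_eq_of_noKMixing hK i j m hm
      rw [hp, hp, hf0, mul_right_inj' (C.t_ne m), Complex.exp_eq_exp_iff_exists_int] at this
      obtain ⟨n, hn⟩ := this
      refine ⟨n, ?_⟩
      have h3 : Complex.I * (2 * Real.pi) * (f j m i : ℂ) = Complex.I * (2 * Real.pi) * (n : ℂ) := by
        push_cast at hn
        linear_combination hn
      have h4 : Complex.I * (2 * Real.pi) ≠ 0 := by
        simp [Real.pi_ne_zero]
      exact_mod_cast mul_left_cancel₀ h4 h3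
  exact ⟨⟨fun h => noKMixing_of_eqBZIntegral_kernelForm hBZ (h1 h), h2⟩,
    ⟨h1, fun h => h2 (noKMixing_of_eqBZIntegral_kernelForm hBZ h)⟩⟩

end Crystal

/-! ### Line integrals of linear fields -/

theorem IVec.toVec_add (v w : IVec) : (v + w).toVec = v.toVec + w.toVec := by
  funext a
  simp [IVec.toVec]

theorem IVec.toVec_sub (v w : IVec) : (v - w).toVec = v.toVec - w.toVec := by
  funext a
  simp [IVec.toVec]

theorem IVec.toVec_zero : IVec.toVec 0 = 0 := by
  funext a
  simp [IVec.toVec]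

theorem IVec.toVec_single (a : Fin 2) : IVec.toVec (Pi.single a 1) = Pi.single a 1 := by
  funext b
  simp [IVec.toVec, Pi.single_apply]

/-- A linear field integrates to its value at the midpoint, paired with the displacement. -/
theorem segmentIntegral_mulVec (B : Matrix (Fin 2) (Fin 2) ℝ) (x y : Vec) :
    segmentIntegral (fun r => B *ᵥ r) x y = 1 / 2 * ((B *ᵥ (x + y)) ⬝ᵥ (y - x)) := by
  have h1 : ∀ s : ℝ, (B *ᵥ (x + s • (y - x))) ⬝ᵥ (y - x) =
      (B *ᵥ x) ⬝ᵥ (y - x) + s * ((B *ᵥ (y - x)) ⬝ᵥ (y - x)) := fun s => by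
    rw [mulVec_add, mulVec_smul, add_dotProduct, smul_dotProduct, smul_eq_mul]
  have h2 : x + y = (2 : ℝ) • x + (y - x) := by rw [two_smul]; abel
  simp only [segmentIntegral, h1]
  rw [intervalIntegral.integral_add (by simp) ((by fun_prop : Continuous fun s : ℝ =>
    s * ((B *ᵥ (y - x)) ⬝ᵥ (y - x))).intervalIntegrable _ _), intervalIntegral.integral_const,
    intervalIntegral.integral_mul_const, integral_id, h2, mulVec_add, mulVec_smul,
    add_dotProduct, smul_dotProduct, smul_eq_mul, smul_eq_mul]
  ring

/-! ### Peierls phases in coordinates along the columns of `V` -/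

namespace Crystal

variable {N M : ℕ} (C : Crystal N M)

/-- The factor `V⁻¹` of the field cancels the `V` of the position, and `(Vᵀ)⁻¹` cancels the `V` of
the displacement. -/
theorem segmentIntegral_linearField (h q : ℝ) (A : Matrix (Fin 2) (Fin 2) ℝ) (u w : Vec) :
    segmentIntegral (C.linearField h q A) (C.V *ᵥ u) (C.V *ᵥ w) =
      h / q * segmentIntegral (fun r => A *ᵥ r) u w := by
  rw [segmentIntegral, segmentIntegral, ← intervalIntegral.integral_const_mul]
  refine intervalIntegral.integral_congr fun s _ => ?_
  have h1 : C.V *ᵥ u + s • (C.V *ᵥ w - C.V *ᵥ u) = C.V *ᵥ (u + s • (w - u)) := by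
    rw [mulVec_add, mulVec_smul, mulVec_sub]
  have h2 : C.V⁻¹ *ᵥ (C.V *ᵥ (u + s • (w - u))) = u + s • (w - u) := by
    rw [mulVec_mulVec, nonsing_inv_mul _ C.isUnit_det_V, one_mulVec]
  simp only [h1, linearField]
  rw [h2, smul_dotProduct, smul_eq_mul,
    ← mulVec_sub, dotProduct_mulVec, ← mulVec_transpose, mulVec_mulVec,
    mul_nonsing_inv _ (by rw [det_transpose]; exact C.isUnit_det_V), one_mulVec]

theorem toVec_T_mulVec (i : IVec) : IVec.toVec (C.T *ᵥ i) = C.Tr *ᵥ i.toVec := by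
  funext a
  simp [IVec.toVec, Tr, mulVec, dotProduct]

/-- `j + Δ_m + V⁻¹ R_{n_m'}`. -/
def hopEnd (j : C.J) (m : Fin M) : Vec := (j.1 + C.Δ m).toVec + C.V⁻¹ *ᵥ C.pos (C.tgt m)

theorem mulVec_add_inv_mulVec (x r : Vec) : C.V *ᵥ x + r = C.V *ᵥ (x + C.V⁻¹ *ᵥ r) := by
  rw [mulVec_add, mulVec_mulVec, mul_nonsing_inv _ C.isUnit_det_V, one_mulVec]

theorem startPoint_eq (i : IVec) (j : C.J) (m : Fin M) :
    C.startPoint i j m = C.V *ᵥ (C.Tr *ᵥ i.toVec + C.startRel j m) := by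
  rw [startPoint, startRel, mulVec_add_inv_mulVec, IVec.toVec_add, toVec_T_mulVec, add_assoc]

theorem endPoint_eq (i : IVec) (j : C.J) (m : Fin M) :
    C.endPoint i j m = C.V *ᵥ (C.Tr *ᵥ i.toVec + C.hopEnd j m) := by
  rw [endPoint, hopEnd, mulVec_add_inv_mulVec, add_assoc, IVec.toVec_add, toVec_T_mulVec,
    add_assoc]

theorem hopEnd_eq (j : C.J) (m : Fin M) :
    C.hopEnd j m = C.Tr *ᵥ (C.shift j m).toVec + C.endRel j m := by
  have h : (C.remT (j.1 + C.Δ m)).toVec =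
      (j.1 + C.Δ m).toVec - C.Tr *ᵥ (C.shift j m).toVec := by
    rw [remT, IVec.toVec_sub, toVec_T_mulVec, shift]
  rw [hopEnd, endRel, h]
  abel

theorem hopEnd_sub_startRel (j : C.J) (m : Fin M) :
    C.hopEnd j m - C.startRel j m =
      (C.Δ m).toVec + C.V⁻¹ *ᵥ (C.pos (C.tgt m) - C.pos (C.src m)) := by
  rw [hopEnd, startRel, IVec.toVec_add, mulVec_sub]
  abel

/-- The Peierls amplitude in units of the columns of `V`. -/
theorem peierls_eq {h q : ℝ} (hh : 0 < h) (hq : q ≠ 0) (A : Matrix (Fin 2) (Fin 2) ℝ)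
    (a : VectorPotential) (hfield : a.field = C.linearField h q A) (i : IVec) (j : C.J)
    (m : Fin M) {θ g g' : ℝ} (hg : a.gauge (C.startPoint i j m) = h / q * g)
    (hg' : a.gauge (C.endPoint i j m) = h / q * g')
    (hθ : θ = 2 * Real.pi * (segmentIntegral (fun r => A *ᵥ r)
      (C.Tr *ᵥ i.toVec + C.startRel j m) (C.Tr *ᵥ i.toVec + C.hopEnd j m) + (g' - g))) :
    C.peierls h q a i j m = C.t m * Complex.exp (Complex.I * (θ : ℂ)) := by
  rw [peierls, VectorPotential.lineIntegral, hg, hg', hfield, startPoint_eq, endPoint_eq,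
    segmentIntegral_linearField, hθ]
  have h0 := hh.ne'
  congr 4
  field_simp

/-! ### The linear vector potential -/

theorem forall_hopVectors_iff (A : Matrix (Fin 2) (Fin 2) ℝ) :
    (∀ R ∈ C.hopVectors, ∃ z : IVec, C.Trᵀ *ᵥ (Aᵀ *ᵥ R) = z.toVec) ↔
      ∀ (j : C.J) (m : Fin M) (i : IVec), ∃ n : ℤ,
        (A *ᵥ (C.Tr *ᵥ i.toVec)) ⬝ᵥ (C.hopEnd j m - C.startRel j m) = n := by
  have hdot : ∀ (i : IVec) (R : Vec),
      (A *ᵥ (C.Tr *ᵥ i.toVec)) ⬝ᵥ R = i.toVec ⬝ᵥ (C.Trᵀ *ᵥ (Aᵀ *ᵥ R)) := fun i R => by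
    rw [mulVec_transpose, mulVec_transpose, ← dotProduct_comm R, dotProduct_mulVec,
      dotProduct_mulVec, dotProduct_comm]
  simp only [hopVectors, Set.forall_mem_range, hopEnd_sub_startRel, hdot]
  constructor
  · intro H j m i
    obtain ⟨z, hz⟩ := H m
    exact ⟨i ⬝ᵥ z, by rw [hz]; simp [dotProduct, IVec.toVec]⟩
  · intro H m
    -- The displacement does not depend on `j`, so any element of `J` will do; integrality is tested
    -- on unit vectors `i`.
    choose z hz using fun a => H ⟨_, C.remT_mem 0⟩ m (Pi.single a 1)
    refine ⟨z, funext fun a => ?_⟩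
    have := hz a
    rwa [IVec.toVec_single, single_one_dotProduct] at this

theorem linearPotential_iff [LinearOrder C.Site] {h q : ℝ} (hh : 0 < h) (hq : q ≠ 0)
    (A : Matrix (Fin 2) (Fin 2) ℝ) {BZ : Set Vec}
    (hBZ : IsAddFundamentalDomain C.reciprocalLattice BZ volume) :
    ((∀ R ∈ C.hopVectors, ∃ z : IVec, C.Trᵀ *ᵥ (Aᵀ *ᵥ R) = z.toVec) ↔
        C.NoKMixing BZ (C.hamiltonian h q (C.linearPotential h q A))) ∧
      ((∀ R ∈ C.hopVectors, ∃ z : IVec, C.Trᵀ *ᵥ (Aᵀ *ᵥ R) = z.toVec) ↔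
        C.EqBZIntegral BZ (C.hamiltonian h q (C.linearPotential h q A))
          fun k => C.kernelForm (C.linearPhase A k) k) := by
  refine integrality_iff_noKMixing hBZ
    (θ := fun j m => 2 * Real.pi * segmentIntegral (fun R => A *ᵥ R) (C.startRel j m)
      (C.hopEnd j m))
    -- Translating the segment by `T i` adds the constant `A T i` to the field along it.
    (f := fun j m i => (A *ᵥ (C.Tr *ᵥ i.toVec)) ⬝ᵥ (C.hopEnd j m - C.startRel j m))
    (fun i j m => ?_) (fun k j m => rfl) (fun j m => ?_) (fun j m hst hΔ i => ?_)
    (C.forall_hopVectors_iff A)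
  · refine C.peierls_eq hh hq A _ rfl i j m (g := 0) (g' := 0) (by simp [linearPotential])
      (by simp [linearPotential]) ?_
    have h2 : C.Tr *ᵥ i.toVec + C.startRel j m + (C.Tr *ᵥ i.toVec + C.hopEnd j m) =
        (2 : ℝ) • (C.Tr *ᵥ i.toVec) + (C.startRel j m + C.hopEnd j m) := by
      rw [two_smul]
      abel
    rw [segmentIntegral_mulVec, segmentIntegral_mulVec, add_sub_add_left_eq_sub, h2,
      mulVec_add A (_ • _), mulVec_smul, add_dotProduct, smul_dotProduct, smul_eq_mul]
    ring
  · simp [IVec.toVec_zero]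
  · simp [hopEnd_sub_startRel, hst, hΔ, IVec.toVec_zero]

/-! ### The nonlinear vector potential -/

theorem floorT_add (i v : IVec) : C.floorT (C.T *ᵥ i + v) = i + C.floorT v := by
  funext a
  rw [floorT, latticeFloor, IVec.toVec_add, toVec_T_mulVec, mulVec_add, mulVec_mulVec,
    nonsing_inv_mul _ C.isUnit_det_Tr, one_mulVec]
  exact Int.floor_intCast_add _ _

theorem unitCell_mulVec_add (v : IVec) {r : Vec} (hr : C.unitCell r = 0) :
    C.unitCell (C.V *ᵥ v.toVec + r) = v := by
  funext a
  rw [unitCell, latticeFloor, mulVec_add, mulVec_mulVec, nonsing_inv_mul _ C.isUnit_det_V,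
    one_mulVec]
  have : ⌊(C.V⁻¹ *ᵥ r) a⌋ = 0 := congrFun hr a
  exact (Int.floor_intCast_add _ _).trans (by rw [this, add_zero])

/-- Since the atom lies in its unit cell and `j ∈ J`, the magnetic cell of the point is exactly `i`
and its remainder is `V x`. This is where the hypothesis on the atomic positions enters. -/
theorem gaugeFunction_apply (h q : ℝ) (A : Matrix (Fin 2) (Fin 2) ℝ) (i : IVec) {j : IVec}
    (hj : C.floorT j = 0) {r x : Vec} (hr : C.unitCell r = 0) (hx : x = j.toVec + C.V⁻¹ *ᵥ r) :
    C.gaugeFunction h q A (C.V *ᵥ (C.Tr *ᵥ i.toVec + x)) =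
      h / q * (-((A *ᵥ (C.Tr *ᵥ i.toVec)) ⬝ᵥ x) - 1 / 2 * (x ⬝ᵥ (A *ᵥ x))) := by
  have h1 : C.magCell (C.V *ᵥ (C.Tr *ᵥ i.toVec + x)) = i := by
    rw [magCell, hx, ← add_assoc, ← toVec_T_mulVec, ← IVec.toVec_add, ← mulVec_add_inv_mulVec,
      unitCell_mulVec_add _ _ hr, floorT_add, hj, add_zero]
  have h2 : C.magRem (C.V *ᵥ (C.Tr *ᵥ i.toVec + x)) = C.V *ᵥ x := by
    rw [magRem, h1, mulVec_add, add_sub_cancel_left]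
  have h3 : ∀ v w : Vec, ((C.Vᵀ)⁻¹ *ᵥ v) ⬝ᵥ (C.V *ᵥ w) = v ⬝ᵥ w := fun v w => by
    rw [dotProduct_mulVec, ← mulVec_transpose, mulVec_mulVec,
      mul_nonsing_inv _ (by rw [det_transpose]; exact C.isUnit_det_V), one_mulVec]
  have h4 : C.V⁻¹ *ᵥ (C.V *ᵥ x) = x := by
    rw [mulVec_mulVec, nonsing_inv_mul _ C.isUnit_det_V, one_mulVec]
  rw [gaugeFunction, h1, h2, h3, dotProduct_comm (C.V *ᵥ x), h3, h4, dotProduct_comm (A *ᵥ x)]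
  ring

/-- Since the hopping network is connected, the changes of magnetic unit cell generate `ℤ²`. -/
theorem exists_int_matrix_iff (A : Matrix (Fin 2) (Fin 2) ℝ) :
    (∃ Z : Matrix (Fin 2) (Fin 2) ℤ, C.Trᵀ * A * C.Tr = Z.map (Int.cast : ℤ → ℝ)) ↔
      ∀ (j : C.J) (m : Fin M) (i : IVec), ∃ n : ℤ,
        (C.Tr *ᵥ (C.shift j m).toVec) ⬝ᵥ (A *ᵥ (C.Tr *ᵥ i.toVec)) = n := by
  have hdot : ∀ s i : IVec, (C.Tr *ᵥ s.toVec) ⬝ᵥ (A *ᵥ (C.Tr *ᵥ i.toVec)) =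
      s.toVec ⬝ᵥ ((C.Trᵀ * A * C.Tr) *ᵥ i.toVec) := fun s i => by
    rw [← vecMul_transpose, ← dotProduct_mulVec, mulVec_mulVec, mulVec_mulVec, Matrix.mul_assoc]
  simp only [hdot]
  constructor
  · rintro ⟨Z, hZ⟩ j m i
    refine ⟨C.shift j m ⬝ᵥ (Z *ᵥ i), ?_⟩
    rw [hZ]
    simp [dotProduct, mulVec, IVec.toVec]
  · intro H
    -- By equivariance of `floorT` under the magnetic lattice, the change of magnetic cell in a hop
    -- from `v` is the shift of the same hop from `remT v ∈ J`.
    have hstep : ∀ (v : IVec) (m : Fin M) (i : IVec), ∃ n : ℤ,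
        (C.floorT (v + C.Δ m) - C.floorT v).toVec ⬝ᵥ ((C.Trᵀ * A * C.Tr) *ᵥ i.toVec) = n := by
      intro v m i
      have hv : C.floorT (v + C.Δ m) - C.floorT v = C.shift ⟨_, C.remT_mem v⟩ m := by
        have : v + C.Δ m = C.T *ᵥ C.floorT v + (C.remT v + C.Δ m) := by
          rw [remT]
          abel
        rw [this, floorT_add, add_sub_cancel_left, shift]
      rw [hv]
      exact H _ m i
    -- The changes of magnetic cell telescope along a walk; an edge traversed backwards only changes
    -- the sign of the integer.
    have hpath : ∀ x y : IVec × Fin N, ∀ i : IVec, ∃ n : ℤ,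
        (C.floorT y.1 - C.floorT x.1).toVec ⬝ᵥ ((C.Trᵀ * A * C.Tr) *ᵥ i.toVec) = n := by
      intro x y i
      obtain ⟨p⟩ := C.connected.preconnected x y
      induction p with
      | nil => exact ⟨0, by simp [IVec.toVec_zero]⟩
      | @cons u v w huv _ ih =>
        obtain ⟨n, hn⟩ := ih
        have hedge : ∃ n : ℤ,
            (C.floorT v.1 - C.floorT u.1).toVec ⬝ᵥ ((C.Trᵀ * A * C.Tr) *ᵥ i.toVec) = n := by
          rw [SimpleGraph.fromRel_adj] at huv
          obtain ⟨-, ⟨m, -, -, e⟩ | ⟨m, -, -, e⟩⟩ := huv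
          · rw [e]
            exact hstep _ m i
          · obtain ⟨n', hn'⟩ := hstep v.1 m i
            refine ⟨-n', ?_⟩
            rw [e, Int.cast_neg, ← hn', ← neg_dotProduct, IVec.toVec_sub, IVec.toVec_sub, neg_sub]
        obtain ⟨n', hn'⟩ := hedge
        refine ⟨n + n', ?_⟩
        rw [Int.cast_add, ← hn, ← hn', ← add_dotProduct, ← IVec.toVec_add, sub_add_sub_cancel]
    have hgen : ∀ a b : Fin 2, ∃ n : ℤ, (C.Trᵀ * A * C.Tr) a b = n := by
      intro a b
      obtain ⟨x⟩ := C.connected.nonempty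
      -- A walk from cell `0` to cell `T e_a` has total change `e_a`, which picks out the entry `(a,
      -- b)`.
      obtain ⟨n, hn⟩ := hpath (0, x.2) (C.T *ᵥ Pi.single a 1, x.2) (Pi.single b 1)
      refine ⟨n, ?_⟩
      have h1 := C.floorT_add (Pi.single a 1) 0
      rw [add_zero] at h1
      rwa [h1, add_sub_cancel_right, IVec.toVec_single, IVec.toVec_single, mulVec_single_one,
        single_one_dotProduct] at hn
    choose Z hZ using hgen
    exact ⟨Matrix.of Z, by ext a b; exact hZ a b⟩

/-- The Peierls phase of the nonlinear vector potential between two magnetic unit cells. -/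
theorem gauged_phase_eq (A : Matrix (Fin 2) (Fin 2) ℝ) (a D x y : Vec) :
    segmentIntegral (fun r => A *ᵥ r) (a + x) (a + (D + y)) +
        ((-((A *ᵥ (a + D)) ⬝ᵥ y) - 1 / 2 * (y ⬝ᵥ (A *ᵥ y))) -
          (-((A *ᵥ a) ⬝ᵥ x) - 1 / 2 * (x ⬝ᵥ (A *ᵥ x)))) =
      1 / 2 * (D ⬝ᵥ (((1 / 2 : ℝ) • (A + Aᵀ)) *ᵥ D)) +
        y ⬝ᵥ (((1 / 2 : ℝ) • (A - Aᵀ)) *ᵥ x) +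
        D ⬝ᵥ (((1 / 2 : ℝ) • (A - Aᵀ)) *ᵥ (y + x)) + D ⬝ᵥ (A *ᵥ a) := by
  rw [segmentIntegral_mulVec]
  simp only [dotProduct, mulVec, Fin.sum_univ_two, Pi.add_apply, Pi.sub_apply, Matrix.smul_apply,
    Matrix.add_apply, Matrix.sub_apply, transpose_apply, smul_eq_mul]
  ring

theorem nonlinearPotential_iff [LinearOrder C.Site] {h q : ℝ} (hh : 0 < h) (hq : q ≠ 0)
    (A : Matrix (Fin 2) (Fin 2) ℝ) {BZ : Set Vec}
    (hBZ : IsAddFundamentalDomain C.reciprocalLattice BZ volume)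
    (hpos : ∀ n, C.unitCell (C.pos n) = 0) :
    ((∃ Z : Matrix (Fin 2) (Fin 2) ℤ, C.Trᵀ * A * C.Tr = Z.map (Int.cast : ℤ → ℝ)) ↔
        C.NoKMixing BZ (C.hamiltonian h q (C.nonlinearPotential h q A))) ∧
      ((∃ Z : Matrix (Fin 2) (Fin 2) ℤ, C.Trᵀ * A * C.Tr = Z.map (Int.cast : ℤ → ℝ)) ↔
        C.EqBZIntegral BZ (C.hamiltonian h q (C.nonlinearPotential h q A))
          fun k => C.kernelForm (C.nonlinearPhase A k) k) := by
  refine integrality_iff_noKMixing hBZ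
    (θ := fun j m => 2 * Real.pi *
      (1 / 2 * ((C.Tr *ᵥ (C.shift j m).toVec) ⬝ᵥ
          (((1 / 2 : ℝ) • (A + Aᵀ)) *ᵥ (C.Tr *ᵥ (C.shift j m).toVec))) +
        C.endRel j m ⬝ᵥ (((1 / 2 : ℝ) • (A - Aᵀ)) *ᵥ C.startRel j m) +
        (C.Tr *ᵥ (C.shift j m).toVec) ⬝ᵥ
          (((1 / 2 : ℝ) • (A - Aᵀ)) *ᵥ (C.endRel j m + C.startRel j m))))
    -- The last term of `gauged_phase_eq` with `a = T i`, the only one that contains `i`.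
    (f := fun j m i => (C.Tr *ᵥ (C.shift j m).toVec) ⬝ᵥ (A *ᵥ (C.Tr *ᵥ i.toVec)))
    (fun i j m => ?_) (fun k j m => ?_) (fun j m => ?_) (fun j m hst hΔ i => ?_)
    (C.exists_int_matrix_iff A)
  · have hend : C.endPoint i j m =
        C.V *ᵥ (C.Tr *ᵥ (i + C.shift j m).toVec + C.endRel j m) := by
      rw [endPoint_eq, hopEnd_eq, IVec.toVec_add, mulVec_add C.Tr, add_assoc]
    have hg : C.gaugeFunction h q A (C.startPoint i j m) = _ := (congrArg _
      (C.startPoint_eq i j m)).trans (C.gaugeFunction_apply h q A i j.2 (hpos (C.src m)) rfl)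
    have hg' : C.gaugeFunction h q A (C.endPoint i j m) = _ := (congrArg _ hend).trans
      (C.gaugeFunction_apply h q A _ (C.remT_mem (j.1 + C.Δ m)) (hpos (C.tgt m)) rfl)
    refine C.peierls_eq hh hq A (C.nonlinearPotential h q A) rfl i j m hg hg' ?_
    rw [hopEnd_eq, IVec.toVec_add, mulVec_add C.Tr, gauged_phase_eq]
    ring
  · simp only [nonlinearPhase]
    ring
  · simp [IVec.toVec_zero]
  -- With `Δ = 0` the hop stays in `j ∈ J`, so the magnetic cell does not change.
  · have : C.shift j m = 0 := by
      rw [shift, hΔ, add_zero]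
      exact j.2
    simp [this, IVec.toVec_zero]

end Crystal

end TightBinding

end

theorem mainTheorem1 (N M : ℕ) (C : TightBinding.Crystal N M) [LinearOrder C.Site]
    (h q : ℝ) (hh : 0 < h) (hq : q ≠ 0) (A : Matrix (Fin 2) (Fin 2) ℝ)
    (BZ : Set TightBinding.Vec)
    (hBZ : IsAddFundamentalDomain C.reciprocalLattice BZ volume) :
    -- the linear vector potential
    (((∀ R ∈ C.hopVectors, ∃ z : TightBinding.IVec, C.Trᵀ *ᵥ (Aᵀ *ᵥ R) = z.toVec) ↔
        C.NoKMixing BZ (C.hamiltonian h q (C.linearPotential h q A))) ∧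
      ((∀ R ∈ C.hopVectors, ∃ z : TightBinding.IVec, C.Trᵀ *ᵥ (Aᵀ *ᵥ R) = z.toVec) ↔
        C.EqBZIntegral BZ (C.hamiltonian h q (C.linearPotential h q A))
          fun k => C.kernelForm (C.linearPhase A k) k)) ∧
    -- the nonlinear vector potential
    ((∀ n, C.unitCell (C.pos n) = 0) →
      ((∃ Z : Matrix (Fin 2) (Fin 2) ℤ, C.Trᵀ * A * C.Tr = Z.map (Int.cast : ℤ → ℝ)) ↔
        C.NoKMixing BZ (C.hamiltonian h q (C.nonlinearPotential h q A))) ∧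
      ((∃ Z : Matrix (Fin 2) (Fin 2) ℤ, C.Trᵀ * A * C.Tr = Z.map (Int.cast : ℤ → ℝ)) ↔
        C.EqBZIntegral BZ (C.hamiltonian h q (C.nonlinearPotential h q A))
          fun k => C.kernelForm (C.nonlinearPhase A k) k)) :=
  ⟨C.linearPotential_iff hh hq A hBZ, C.nonlinearPotential_iff hh hq A hBZ⟩
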